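/- A trajectory $\mathcal{T}$ with $n\ge 1$ vertices is a polygonal curve in the plane parametrised by time: it is given by times $\tau_1<\dots<\tau_n$ and vertices $v_1,\dots,v_n\in\mathbb{R}^2$, satisfies $\mathcal{T}(\tau_i)=v_i$, and is affine on each interval $[\tau_i,\tau_{i+1}]$. For $\tau_1\le s\le t\le\tau_n$ the subtrajectory $\mathcal{T}[s,t]$ is the restriction of $\mathcal{T}$ to $[s,t]$. It is 1-coverable if its image is contained in some closed axis-parallel square of side length $1$, and it is a longest 1-coverable subtrajectory if no 1-coverable subtrajectory of $\mathcal{T}$ has larger Euclidean length. Theorem. There is a real RAM algorithm (unit-cost arithmetic operations, square roots and comparisons of real numbers; rational constants) that, given any trajectory $\mathcal{T}$ with $n$ vertices (the coordinates and times of the vertices), computes, in $O(n\log n)$ time, two times $s\le t$ such that $\mathcal{T}[s,t]$ is a longest 1-coverable subtrajectory of $\mathcal{T}$. -/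

import Mathlib

open Filter Asymptotics

/-! ## Real RAM

A random access machine with two kinds of data, natural numbers and (exact) real numbers.  A program
uses finitely many named registers and arrays of either kind; an array cell is addressed by the
content of a natural number register.  Every elementary instruction and every test costs one step.
There is no conversion between the two kinds of data (in particular no rounding), no multiplication
of natural numbers, and the constants in a program are rational. -/

namespace RealRAM

/-- Memory contents: registers and arrays, of natural numbers and of real numbers. -/
@[ext]
structure State where
  nat : ℕ → ℕ
  real : ℕ → ℝ
  natArr : ℕ → ℕ → ℕ
  realArr : ℕ → ℕ → ℝ

/-- Right-hand sides of assignments to a natural number register; `a`, `b` are names of natural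
number registers. -/
inductive NatRhs where
  | const (k : ℕ)
  | copy (a : ℕ)
  | add (a b : ℕ)
  | sub (a b : ℕ)
  | half (a : ℕ)
  /-- the cell of the array `A` whose index is the content of the natural number register `a` -/
  | load (A a : ℕ)

/-- Right-hand sides of assignments to a real register; `a`, `b` are names of real registers. -/
inductive RealRhs where
  | const (q : ℚ)
  | copy (a : ℕ)
  | add (a b : ℕ)
  | sub (a b : ℕ)
  | mul (a b : ℕ)
  | div (a b : ℕ)
  | sqrt (a : ℕ)
  /-- the cell of the array `A` whose index is the content of the natural number register `i` -/
  | load (A i : ℕ)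

/-- Elementary instructions. -/
inductive Instr where
  /-- assign to the natural number register `d` -/
  | setNat (d : ℕ) (e : NatRhs)
  /-- assign to the real register `d` -/
  | setReal (d : ℕ) (e : RealRhs)
  /-- store the natural number register `v` into the cell of `A` addressed by the register `i` -/
  | storeNat (A i v : ℕ)
  /-- store the real register `v` into the cell of `A` addressed by the register `i` -/
  | storeReal (A i v : ℕ)

/-- Tests: comparisons of two registers of the same kind. -/
inductive Test where
  | natLt (a b : ℕ)
  | natLe (a b : ℕ)
  | realLt (a b : ℕ)
  | realLe (a b : ℕ)

/-- Programs. -/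
inductive Program where
  | skip
  | instr (c : Instr)
  | seq (P Q : Program)
  | ite (b : Test) (P Q : Program)
  | loop (b : Test) (P : Program)

def NatRhs.eval (σ : State) : NatRhs → ℕ
  | const k => k
  | copy a => σ.nat a
  | add a b => σ.nat a + σ.nat b
  | sub a b => σ.nat a - σ.nat b
  | half a => σ.nat a / 2
  | load A a => σ.natArr A (σ.nat a)

noncomputable def RealRhs.eval (σ : State) : RealRhs → ℝ
  | const q => (q : ℝ)
  | copy a => σ.real a
  | add a b => σ.real a + σ.real b
  | sub a b => σ.real a - σ.real b
  | mul a b => σ.real a * σ.real b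
  | div a b => σ.real a / σ.real b
  | sqrt a => Real.sqrt (σ.real a)
  | load A i => σ.realArr A (σ.nat i)

/-- The effect of an elementary instruction on the memory. -/
noncomputable def Instr.exec (σ : State) : Instr → State
  | setNat d e => { σ with nat := Function.update σ.nat d (e.eval σ) }
  | setReal d e => { σ with real := Function.update σ.real d (e.eval σ) }
  | storeNat A i v =>
      { σ with natArr :=
          Function.update σ.natArr A (Function.update (σ.natArr A) (σ.nat i) (σ.nat v)) }
  | storeReal A i v =>
      { σ with realArr :=
          Function.update σ.realArr A (Function.update (σ.realArr A) (σ.nat i) (σ.real v)) }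

def Test.Holds (σ : State) : Test → Prop
  | natLt a b => σ.nat a < σ.nat b
  | natLe a b => σ.nat a ≤ σ.nat b
  | realLt a b => σ.real a < σ.real b
  | realLe a b => σ.real a ≤ σ.real b

/-- `Run P σ σ' k`: started with memory `σ`, the program `P` halts with memory `σ'` after exactly
`k` steps. -/
inductive Run : Program → State → State → ℕ → Prop where
  | skip (σ : State) : Run .skip σ σ 1
  | instr (c : Instr) (σ : State) : Run (.instr c) σ (c.exec σ) 1
  | seq {P Q : Program} {σ σ' σ'' : State} {k l : ℕ} :
      Run P σ σ' k → Run Q σ' σ'' l → Run (.seq P Q) σ σ'' (k + l)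
  | iteTrue {b : Test} {P Q : Program} {σ σ' : State} {k : ℕ} :
      b.Holds σ → Run P σ σ' k → Run (.ite b P Q) σ σ' (k + 1)
  | iteFalse {b : Test} {P Q : Program} {σ σ' : State} {k : ℕ} :
      ¬ b.Holds σ → Run Q σ σ' k → Run (.ite b P Q) σ σ' (k + 1)
  | loopTrue {b : Test} {P : Program} {σ σ' σ'' : State} {k l : ℕ} :
      b.Holds σ → Run P σ σ' k → Run (.loop b P) σ' σ'' l → Run (.loop b P) σ σ'' (k + l + 1)
  | loopFalse {b : Test} {P : Program} {σ : State} :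
      ¬ b.Holds σ → Run (.loop b P) σ σ 1

/-- The machine is deterministic: the final memory and the number of steps are determined by the
program and the initial memory. -/
theorem Run.deterministic {P : Program} {σ σ₁ σ₂ : State} {k₁ k₂ : ℕ}
    (h₁ : Run P σ σ₁ k₁) (h₂ : Run P σ σ₂ k₂) : σ₁ = σ₂ ∧ k₁ = k₂ := by
  induction h₁ generalizing σ₂ k₂ with
  | skip σ => cases h₂; exact ⟨rfl, rfl⟩
  | instr c σ => cases h₂; exact ⟨rfl, rfl⟩
  | seq _ _ ih ih' =>
    cases h₂ with
    | seq a b =>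
      obtain ⟨rfl, rfl⟩ := ih a
      obtain ⟨rfl, rfl⟩ := ih' b
      exact ⟨rfl, rfl⟩
  | iteTrue hb _ ih =>
    cases h₂ with
    | iteTrue _ a => obtain ⟨rfl, rfl⟩ := ih a; exact ⟨rfl, rfl⟩
    | iteFalse hb' _ => exact absurd hb hb'
  | iteFalse hb _ ih =>
    cases h₂ with
    | iteTrue hb' _ => exact absurd hb' hb
    | iteFalse _ a => obtain ⟨rfl, rfl⟩ := ih a; exact ⟨rfl, rfl⟩
  | loopTrue hb _ _ ih ih' =>
    cases h₂ with
    | loopTrue _ a b =>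
      obtain ⟨rfl, rfl⟩ := ih a
      obtain ⟨rfl, rfl⟩ := ih' b
      exact ⟨rfl, rfl⟩
    | loopFalse hb' => exact absurd hb hb'
  | loopFalse hb =>
    cases h₂ with
    | loopTrue hb' _ _ => exact absurd hb' hb
    | loopFalse _ => exact ⟨rfl, rfl⟩

end RealRAM

/-! ## Coverings by unit squares -/

/-- The Euclidean plane. -/
abbrev Plane : Type := EuclideanSpace ℝ (Fin 2)

/-- The closed axis-parallel unit square with lower left corner `c`. -/
def unitSquare (c : Plane) : Set Plane :=
  {p | ∀ d : Fin 2, c d ≤ p d ∧ p d ≤ c d + 1}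

/-- `S` is contained in the union of `k` axis-parallel unit squares. -/
def IsCoverable (k : ℕ) (S : Set Plane) : Prop :=
  ∃ c : Fin k → Plane, S ⊆ ⋃ j, unitSquare (c j)

/-! ## Trajectories -/

/-- A trajectory with `n` vertices: a polygonal curve in the plane, parametrised by time. It passes
its vertices at the times `time 0 < ⋯ < time (n - 1)`, and traverses the edge between two consecutive
vertices affinely. Only the values of `curve` between the first and the last time matter. -/
structure Trajectory (n : ℕ) where
  pos : 0 < n
  time : Fin n → ℝ
  strictMono_time : StrictMono time
  curve : ℝ → Plane
  affine_edge : ∀ (i : ℕ) (hi : i + 1 < n), ∀ u ∈ Set.Icc (0 : ℝ) 1,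
    curve (AffineMap.lineMap (time ⟨i, by omega⟩) (time ⟨i + 1, hi⟩) u) =
      AffineMap.lineMap (curve (time ⟨i, by omega⟩)) (curve (time ⟨i + 1, hi⟩)) u

namespace Trajectory

variable {n : ℕ}

/-- The `i`-th vertex. -/
def vertex (T : Trajectory n) (i : Fin n) : Plane := T.curve (T.time i)

def startTime (T : Trajectory n) : ℝ := T.time ⟨0, T.pos⟩

def endTime (T : Trajectory n) : ℝ := T.time ⟨n - 1, Nat.sub_lt T.pos one_pos⟩

/-- The set of points visited by the subtrajectory `T[s,t]`. -/
def trace (T : Trajectory n) (s t : ℝ) : Set Plane := T.curve '' Set.Icc s t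

/-- The (Euclidean) length of the subtrajectory `T[s,t]`. -/
noncomputable def length (T : Trajectory n) (s t : ℝ) : ENNReal :=
  eVariationOn T.curve (Set.Icc s t)

/-- `T[s,t]` is a `k`-coverable subtrajectory of `T`. -/
def IsCoverableSub (T : Trajectory n) (k : ℕ) (s t : ℝ) : Prop :=
  T.startTime ≤ s ∧ s ≤ t ∧ t ≤ T.endTime ∧ IsCoverable k (T.trace s t)

/-- `T[s,t]` is a longest `k`-coverable subtrajectory of `T`. -/
def IsLongestCoverableSub (T : Trajectory n) (k : ℕ) (s t : ℝ) : Prop :=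
  T.IsCoverableSub k s t ∧
    ∀ s' t' : ℝ, T.IsCoverableSub k s' t' → T.length s' t' ≤ T.length s t

/-- The initial memory of a machine with input `T`: natural number register `0` holds the number of
vertices, and the first `n` cells of the real arrays `0`, `1`, `2` hold the `x`-coordinates, the
`y`-coordinates and the times of the vertices. All the rest is `0`. -/
noncomputable def input (T : Trajectory n) : RealRAM.State where
  nat := Function.update (fun _ => 0) 0 n
  real := fun _ => 0
  natArr := fun _ _ => 0
  realArr := fun A i =>
    if h : i < n then
      if A = 0 then T.vertex ⟨i, h⟩ 0
      else if A = 1 then T.vertex ⟨i, h⟩ 1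
      else if A = 2 then T.time ⟨i, h⟩
      else 0
    else 0

end Trajectory

/-! A subtrajectory lies in a unit square exactly when any two of its points differ by at most 1 in
each coordinate. Coordinates are affine along an edge, so only its two ends and the vertices between
matter. If these vertices are `a, …, b`, the start is parametrised by `u` on the edge entering `a`
and the end by `w` on the edge leaving `b`. Coverability then becomes a fixed number of linear
inequalities in `(u, w)` whose data are the extreme coordinates of the window
(`isCoverable_trace_iff`). Length is linear in `(u, w)` too (`arc_lineMap`). The optimum is attained
at a crossing of two boundary lines (`exists_vertex_ge`), so trying all pairs of constraints solves
the program in constant time.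

Only linearly many windows are needed. Coverability passes to smaller windows, so two pointers
suffice: `b` advances while the enlarged window fits in a square, otherwise `a` advances. When `b`
cannot advance, no coverable piece starting before vertex `a` reaches vertex `b + 1`, so the
programs already solved account for all pieces lost by moving `a`. Pieces inside the window are no
longer than the window, and pieces inside one edge can be slid to its start
(`exists_isCoverableSub_of_edge`).

The extreme coordinates are maintained as in a queue made of two stacks: suffix maxima up to a pivot
`m`, and one running maximum from `m` on. The suffix maxima are rebuilt when `a` passes `m`, and the
cost is amortised by `Mem.potential`. The total time is linear, which is more than the theorem asks
for. -/

/-! ## A shallow embedding of constant-time computations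

The variables of the algorithm form the record `Mem`; `Rep σ s` says that the memory `σ` of the
machine holds the variables `s`. Functions on `Mem` are shown to be computable in constant time by
closure properties, the programs being kept under existential quantifiers. -/

namespace RealRAM

/-- The variables of the algorithm. -/
structure Mem where
  n : ℕ
  a : ℕ
  b : ℕ
  m : ℕ
  k : ℕ
  d : ℕ
  bs : ℝ
  bt : ℝ
  best : ℝ
  D : ℝ
  F : Fin 4 → ℝ
  x : ℕ → ℝ
  y : ℕ → ℝ
  t : ℕ → ℝ
  S : Fin 4 → ℕ → ℝ

/-- The memory `σ` holds the variables `s`; the registers from `8` on are scratch space. -/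
structure Rep (σ : State) (s : Mem) : Prop where
  n : σ.nat 0 = s.n
  a : σ.nat 1 = s.a
  b : σ.nat 2 = s.b
  m : σ.nat 3 = s.m
  k : σ.nat 4 = s.k
  d : σ.nat 5 = s.d
  bs : σ.real 0 = s.bs
  bt : σ.real 1 = s.bt
  best : σ.real 2 = s.best
  D : σ.real 3 = s.D
  F : ∀ c : Fin 4, σ.real (4 + c) = s.F c
  x : σ.realArr 0 = s.x
  y : σ.realArr 1 = s.y
  t : σ.realArr 2 = s.t
  S : ∀ c : Fin 4, σ.realArr (3 + c) = s.S c

theorem Rep.congr {σ σ' : State} {s : Mem} (h : Rep σ s) (hn : ∀ r < 8, σ'.nat r = σ.nat r)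
    (hr : ∀ r < 8, σ'.real r = σ.real r) (hA : σ'.realArr = σ.realArr) : Rep σ' s where
  n := (hn 0 (by norm_num)).trans h.n
  a := (hn 1 (by norm_num)).trans h.a
  b := (hn 2 (by norm_num)).trans h.b
  m := (hn 3 (by norm_num)).trans h.m
  k := (hn 4 (by norm_num)).trans h.k
  d := (hn 5 (by norm_num)).trans h.d
  bs := (hr 0 (by norm_num)).trans h.bs
  bt := (hr 1 (by norm_num)).trans h.bt
  best := (hr 2 (by norm_num)).trans h.best
  D := (hr 3 (by norm_num)).trans h.D
  F c := (hr (4 + c) (by omega)).trans (h.F c)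
  x := hA ▸ h.x
  y := hA ▸ h.y
  t := hA ▸ h.t
  S c := hA ▸ h.S c

theorem Rep.setNat {σ : State} {s : Mem} (h : Rep σ s) {t : ℕ} (ht : 8 ≤ t) (v : ℕ) :
    Rep { σ with nat := Function.update σ.nat t v } s :=
  h.congr (fun r hr => Function.update_of_ne (by omega) _ _) (fun _ _ => rfl) rfl

theorem Rep.setReal {σ : State} {s : Mem} (h : Rep σ s) {t : ℕ} (ht : 8 ≤ t) (v : ℝ) :
    Rep { σ with real := Function.update σ.real t v } s :=
  h.congr (fun _ _ => rfl) (fun r hr => Function.update_of_ne (by omega) _ _) rfl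

/-- `f` can be evaluated in constant time into any scratch register. -/
def NComp (f : Mem → ℕ) : Prop :=
  ∀ t, 8 ≤ t → ∃ (P : Program) (c : ℕ), ∀ σ s, Rep σ s → ∃ σ' k, Run P σ σ' k ∧ k ≤ c ∧ Rep σ' s ∧
    σ'.nat t = f s ∧ (∀ r < t, σ'.nat r = σ.nat r) ∧ σ'.real = σ.real

/-- `f` can be evaluated in constant time into any scratch register. -/
def RComp (f : Mem → ℝ) : Prop :=
  ∀ t, 8 ≤ t → ∃ (P : Program) (c : ℕ), ∀ σ s, Rep σ s → ∃ σ' k, Run P σ σ' k ∧ k ≤ c ∧ Rep σ' s ∧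
    σ'.real t = f s ∧ ∀ r < t, σ'.real r = σ.real r

/-- The state transformation `f` can be performed in constant time. -/
def Impl (f : Mem → Mem) : Prop :=
  ∃ (P : Program) (c : ℕ), ∀ σ s, Rep σ s → ∃ σ' k, Run P σ σ' k ∧ k ≤ c ∧ Rep σ' (f s)

open Classical in
/-- Branching on the condition `p` is possible in constant time. -/
def BComp (p : Mem → Prop) : Prop :=
  ∀ f g, Impl f → Impl g → Impl fun s => if p s then f s else g s

/-! ### Natural numbers -/

theorem NComp.of_rhs {f : Mem → ℕ} (e : NatRhs) (h : ∀ σ s, Rep σ s → e.eval σ = f s) :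
    NComp f := fun t ht => ⟨.instr (.setNat t e), 1, fun σ s hs =>
  ⟨_, 1, Run.instr _ σ, le_rfl, hs.setNat ht _, by simp [Instr.exec, h σ s hs],
    fun r hr => Function.update_of_ne (by omega) _ _, rfl⟩⟩

theorem NComp.const (k : ℕ) : NComp fun _ => k := .of_rhs (.const k) fun _ _ _ => rfl
theorem NComp.n : NComp Mem.n := .of_rhs (.copy 0) fun _ _ h => h.n
theorem NComp.a : NComp Mem.a := .of_rhs (.copy 1) fun _ _ h => h.a
theorem NComp.b : NComp Mem.b := .of_rhs (.copy 2) fun _ _ h => h.b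
theorem NComp.m : NComp Mem.m := .of_rhs (.copy 3) fun _ _ h => h.m
theorem NComp.k : NComp Mem.k := .of_rhs (.copy 4) fun _ _ h => h.k

/-- Evaluation of two functions into consecutive scratch registers. -/
theorem NComp.pair {f g : Mem → ℕ} (hf : NComp f) (hg : NComp g) (t : ℕ) (ht : 8 ≤ t) :
    ∃ (P : Program) (c : ℕ), ∀ σ s, Rep σ s → ∃ σ' k, Run P σ σ' k ∧ k ≤ c ∧ Rep σ' s ∧
      σ'.nat t = f s ∧ σ'.nat (t + 1) = g s ∧ (∀ r < t, σ'.nat r = σ.nat r) ∧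
      σ'.real = σ.real := by
  obtain ⟨P, c, hP⟩ := hf t ht
  obtain ⟨Q, c', hQ⟩ := hg (t + 1) (by omega)
  refine ⟨.seq P Q, c + c', fun σ s hs => ?_⟩
  obtain ⟨σ₁, k₁, r₁, l₁, s₁, e₁, p₁, q₁⟩ := hP σ s hs
  obtain ⟨σ₂, k₂, r₂, l₂, s₂, e₂, p₂, q₂⟩ := hQ σ₁ s s₁
  exact ⟨σ₂, _, r₁.seq r₂, by omega, s₂, by rw [p₂ t (by omega), e₁], e₂,
    fun r hr => by rw [p₂ r (by omega), p₁ r hr], q₂.trans q₁⟩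

theorem NComp.binop {f g h : Mem → ℕ} (hf : NComp f) (hg : NComp g) (e : ℕ → ℕ → NatRhs)
    (he : ∀ t σ s, σ.nat t = f s → σ.nat (t + 1) = g s → (e t (t + 1)).eval σ = h s) :
    NComp h := by
  intro t ht
  obtain ⟨P, c, hP⟩ := hf.pair hg t ht
  refine ⟨.seq P (.instr (.setNat t (e t (t + 1)))), c + 1, fun σ s hs => ?_⟩
  obtain ⟨σ₁, k₁, r₁, l₁, s₁, e₁, e₂, p₁, q₁⟩ := hP σ s hs
  exact ⟨_, _, r₁.seq (Run.instr _ σ₁), by omega, s₁.setNat ht _, by simp [Instr.exec, he t σ₁ s e₁ e₂],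
    fun r hr => by rw [← p₁ r hr]; exact Function.update_of_ne (by omega) _ _, q₁⟩

theorem NComp.add {f g : Mem → ℕ} (hf : NComp f) (hg : NComp g) : NComp fun s => f s + g s :=
  hf.binop hg .add fun t σ s h₁ h₂ => by simp [NatRhs.eval, h₁, h₂]

theorem NComp.sub {f g : Mem → ℕ} (hf : NComp f) (hg : NComp g) : NComp fun s => f s - g s :=
  hf.binop hg .sub fun t σ s h₁ h₂ => by simp [NatRhs.eval, h₁, h₂]

/-! ### Real numbers -/

theorem RComp.of_rhs {f : Mem → ℝ} (e : RealRhs) (h : ∀ σ s, Rep σ s → e.eval σ = f s) :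
    RComp f := fun t ht => ⟨.instr (.setReal t e), 1, fun σ s hs =>
  ⟨_, 1, Run.instr _ σ, le_rfl, hs.setReal ht _, by simp [Instr.exec, h σ s hs],
    fun r hr => Function.update_of_ne (by omega) _ _⟩⟩

theorem RComp.const (q : ℚ) : RComp fun _ => (q : ℝ) := .of_rhs (.const q) fun _ _ _ => rfl
theorem RComp.zero : RComp fun _ => 0 := by simpa using RComp.const 0
theorem RComp.one : RComp fun _ => 1 := by simpa using RComp.const 1
theorem RComp.best : RComp Mem.best := .of_rhs (.copy 2) fun _ _ h => h.best
theorem RComp.D : RComp Mem.D := .of_rhs (.copy 3) fun _ _ h => h.D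
theorem RComp.F (c : Fin 4) : RComp fun s => s.F c := .of_rhs (.copy (4 + c)) fun _ _ h => h.F c

theorem RComp.pair {f g : Mem → ℝ} (hf : RComp f) (hg : RComp g) (t : ℕ) (ht : 8 ≤ t) :
    ∃ (P : Program) (c : ℕ), ∀ σ s, Rep σ s → ∃ σ' k, Run P σ σ' k ∧ k ≤ c ∧ Rep σ' s ∧
      σ'.real t = f s ∧ σ'.real (t + 1) = g s ∧ ∀ r < t, σ'.real r = σ.real r := by
  obtain ⟨P, c, hP⟩ := hf t ht
  obtain ⟨Q, c', hQ⟩ := hg (t + 1) (by omega)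
  refine ⟨.seq P Q, c + c', fun σ s hs => ?_⟩
  obtain ⟨σ₁, k₁, r₁, l₁, s₁, e₁, p₁⟩ := hP σ s hs
  obtain ⟨σ₂, k₂, r₂, l₂, s₂, e₂, p₂⟩ := hQ σ₁ s s₁
  exact ⟨σ₂, _, r₁.seq r₂, by omega, s₂, by rw [p₂ t (by omega), e₁], e₂,
    fun r hr => by rw [p₂ r (by omega), p₁ r hr]⟩

theorem RComp.binop {f g h : Mem → ℝ} (hf : RComp f) (hg : RComp g) (e : ℕ → ℕ → RealRhs)
    (he : ∀ t σ s, σ.real t = f s → σ.real (t + 1) = g s → (e t (t + 1)).eval σ = h s) :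
    RComp h := by
  intro t ht
  obtain ⟨P, c, hP⟩ := hf.pair hg t ht
  refine ⟨.seq P (.instr (.setReal t (e t (t + 1)))), c + 1, fun σ s hs => ?_⟩
  obtain ⟨σ₁, k₁, r₁, l₁, s₁, e₁, e₂, p₁⟩ := hP σ s hs
  exact ⟨_, _, r₁.seq (Run.instr _ σ₁), by omega, s₁.setReal ht _, by simp [Instr.exec, he t σ₁ s e₁ e₂],
    fun r hr => by rw [← p₁ r hr]; exact Function.update_of_ne (by omega) _ _⟩

theorem RComp.add {f g : Mem → ℝ} (hf : RComp f) (hg : RComp g) : RComp fun s => f s + g s :=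
  hf.binop hg .add fun t σ s h₁ h₂ => by simp [RealRhs.eval, h₁, h₂]

theorem RComp.sub {f g : Mem → ℝ} (hf : RComp f) (hg : RComp g) : RComp fun s => f s - g s :=
  hf.binop hg .sub fun t σ s h₁ h₂ => by simp [RealRhs.eval, h₁, h₂]

theorem RComp.mul {f g : Mem → ℝ} (hf : RComp f) (hg : RComp g) : RComp fun s => f s * g s :=
  hf.binop hg .mul fun t σ s h₁ h₂ => by simp [RealRhs.eval, h₁, h₂]

theorem RComp.div {f g : Mem → ℝ} (hf : RComp f) (hg : RComp g) : RComp fun s => f s / g s :=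
  hf.binop hg .div fun t σ s h₁ h₂ => by simp [RealRhs.eval, h₁, h₂]

theorem RComp.sqrt {f : Mem → ℝ} (hf : RComp f) : RComp fun s => √(f s) :=
  -- The argument is evaluated twice, so that the binary combinator also serves for a unary
  -- operation.
  hf.binop hf (fun a _ => .sqrt a) fun t σ s h₁ h₂ => by simp [RealRhs.eval, h₁]

theorem RComp.neg {f : Mem → ℝ} (hf : RComp f) : RComp fun s => -f s := by
  simpa using RComp.zero.sub hf

theorem RComp.max {f g : Mem → ℝ} (hf : RComp f) (hg : RComp g) :
    RComp fun s => max (f s) (g s) := by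
  intro t ht
  obtain ⟨P, c, hP⟩ := hf.pair hg t ht
  refine ⟨.seq P (.ite (.realLe (t + 1) t) .skip (.instr (.setReal t (.copy (t + 1))))), c + 2,
    fun σ s hs => ?_⟩
  obtain ⟨σ₁, k₁, r₁, l₁, s₁, e₁, e₂, p₁⟩ := hP σ s hs
  by_cases hle : σ₁.real (t + 1) ≤ σ₁.real t
  · exact ⟨_, _, r₁.seq (Run.iteTrue hle (Run.skip _)), by omega, s₁,
      by simp only [← e₁, ← e₂, max_eq_left hle], p₁⟩
  · exact ⟨_, _, r₁.seq (Run.iteFalse hle (Run.instr _ _)), by omega, s₁.setReal ht _,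
      by simp [← e₁, ← e₂, max_eq_right (not_le.1 hle).le, Instr.exec, RealRhs.eval],
      fun r hr => by rw [← p₁ r hr]; exact Function.update_of_ne (by omega) _ _⟩

/-- The index goes through the natural number register 8, so evaluating a real may spoil natural
scratch registers. Evaluating an index leaves all real registers alone, as `NComp` demands. -/
theorem RComp.load {i : Mem → ℕ} (hi : NComp i) {arr : Mem → ℕ → ℝ} (A : ℕ)
    (hA : ∀ σ s, Rep σ s → σ.realArr A = arr s) : RComp fun s => arr s (i s) := by
  intro t ht
  obtain ⟨P, c, hP⟩ := hi 8 le_rfl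
  refine ⟨.seq P (.instr (.setReal t (.load A 8))), c + 1, fun σ s hs => ?_⟩
  obtain ⟨σ₁, k₁, r₁, l₁, s₁, e₁, p₁, q₁⟩ := hP σ s hs
  exact ⟨_, _, r₁.seq (Run.instr _ σ₁), by omega, s₁.setReal ht _,
    by simp [Instr.exec, RealRhs.eval, e₁, hA σ₁ s s₁],
    fun r hr => by rw [← q₁]; exact Function.update_of_ne (by omega) _ _⟩

theorem RComp.x {i : Mem → ℕ} (hi : NComp i) : RComp fun s => s.x (i s) :=
  .load hi 0 fun _ _ h => h.x
theorem RComp.y {i : Mem → ℕ} (hi : NComp i) : RComp fun s => s.y (i s) :=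
  .load hi 1 fun _ _ h => h.y
theorem RComp.t {i : Mem → ℕ} (hi : NComp i) : RComp fun s => s.t (i s) :=
  .load hi 2 fun _ _ h => h.t
theorem RComp.S {i : Mem → ℕ} (hi : NComp i) (c : Fin 4) : RComp fun s => s.S c (i s) :=
  .load hi (arr := fun s => s.S c) (3 + c) fun _ _ h => h.S c

/-! ### State transformations -/

theorem Impl.id : Impl fun s => s :=
  ⟨.skip, 1, fun σ _ hs => ⟨σ, 1, Run.skip σ, le_rfl, hs⟩⟩

theorem Impl.comp {f g : Mem → Mem} (hf : Impl f) (hg : Impl g) : Impl fun s => g (f s) := by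
  obtain ⟨P, c, hP⟩ := hf
  obtain ⟨Q, c', hQ⟩ := hg
  refine ⟨.seq P Q, c + c', fun σ s hs => ?_⟩
  obtain ⟨σ₁, k₁, r₁, l₁, s₁⟩ := hP σ s hs
  obtain ⟨σ₂, k₂, r₂, l₂, s₂⟩ := hQ σ₁ _ s₁
  exact ⟨σ₂, _, r₁.seq r₂, by omega, s₂⟩

theorem Impl.foldl {ι : Type*} {f : ι → Mem → Mem} (hf : ∀ i, Impl (f i)) (l : List ι) :
    Impl fun s => l.foldl (fun s i => f i s) s := by
  induction l with
  | nil => exact .id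
  | cons i l ih => exact (hf i).comp ih

theorem Impl.setNat {f : Mem → ℕ} (hf : NComp f) {set : Mem → ℕ → Mem} (r : ℕ)
    (h : ∀ σ s v, Rep σ s → Rep { σ with nat := Function.update σ.nat r v } (set s v)) :
    Impl fun s => set s (f s) := by
  obtain ⟨P, c, hP⟩ := hf 8 le_rfl
  refine ⟨.seq P (.instr (.setNat r (.copy 8))), c + 1, fun σ s hs => ?_⟩
  obtain ⟨σ₁, k₁, r₁, l₁, s₁, e₁, -⟩ := hP σ s hs
  exact ⟨_, _, r₁.seq (Run.instr _ σ₁), by omega, by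
    simpa only [Instr.exec, NatRhs.eval, RealRhs.eval, e₁] using h σ₁ s (f s) s₁⟩

theorem Impl.setReal {f : Mem → ℝ} (hf : RComp f) {set : Mem → ℝ → Mem} (r : ℕ)
    (h : ∀ σ s v, Rep σ s → Rep { σ with real := Function.update σ.real r v } (set s v)) :
    Impl fun s => set s (f s) := by
  obtain ⟨P, c, hP⟩ := hf 8 le_rfl
  refine ⟨.seq P (.instr (.setReal r (.copy 8))), c + 1, fun σ s hs => ?_⟩
  obtain ⟨σ₁, k₁, r₁, l₁, s₁, e₁, -⟩ := hP σ s hs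
  exact ⟨_, _, r₁.seq (Run.instr _ σ₁), by omega, by
    simpa only [Instr.exec, NatRhs.eval, RealRhs.eval, e₁] using h σ₁ s (f s) s₁⟩

theorem Impl.set_a {f : Mem → ℕ} (hf : NComp f) : Impl fun s => { s with a := f s } :=
  .setNat hf (set := fun s v => { s with a := v }) 1 fun σ s v h => by
    constructor <;> simp [h.n, h.b, h.m, h.k, h.d, h.bs, h.bt, h.best, h.D, h.F, h.x, h.y, h.t, h.S]
theorem Impl.set_b {f : Mem → ℕ} (hf : NComp f) : Impl fun s => { s with b := f s } :=
  .setNat hf (set := fun s v => { s with b := v }) 2 fun σ s v h => by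
    constructor <;> simp [h.n, h.a, h.m, h.k, h.d, h.bs, h.bt, h.best, h.D, h.F, h.x, h.y, h.t, h.S]
theorem Impl.set_m {f : Mem → ℕ} (hf : NComp f) : Impl fun s => { s with m := f s } :=
  .setNat hf (set := fun s v => { s with m := v }) 3 fun σ s v h => by
    constructor <;> simp [h.n, h.a, h.b, h.k, h.d, h.bs, h.bt, h.best, h.D, h.F, h.x, h.y, h.t, h.S]
theorem Impl.set_k {f : Mem → ℕ} (hf : NComp f) : Impl fun s => { s with k := f s } :=
  .setNat hf (set := fun s v => { s with k := v }) 4 fun σ s v h => by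
    constructor <;> simp [h.n, h.a, h.b, h.m, h.d, h.bs, h.bt, h.best, h.D, h.F, h.x, h.y, h.t, h.S]
theorem Impl.set_d {f : Mem → ℕ} (hf : NComp f) : Impl fun s => { s with d := f s } :=
  .setNat hf (set := fun s v => { s with d := v }) 5 fun σ s v h => by
    constructor <;> simp [h.n, h.a, h.b, h.m, h.k, h.bs, h.bt, h.best, h.D, h.F, h.x, h.y, h.t, h.S]

theorem Impl.set_D {f : Mem → ℝ} (hf : RComp f) : Impl fun s => { s with D := f s } :=
  .setReal hf (set := fun s v => { s with D := v }) 3 fun σ s v h => by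
    constructor <;> simp [h.n, h.a, h.b, h.m, h.k, h.d, h.bs, h.bt, h.best, h.x, h.y, h.t, h.S]
    intro c
    rw [Function.update_of_ne (by omega), h.F]

/-- Evaluation of four functions into the first scratch registers. -/
theorem RComp.quad {f : Fin 4 → Mem → ℝ} (hf : ∀ c, RComp (f c)) :
    ∃ (P : Program) (c : ℕ), ∀ σ s, Rep σ s → ∃ σ' k, Run P σ σ' k ∧ k ≤ c ∧ Rep σ' s ∧
      σ'.real 8 = f 0 s ∧ σ'.real 9 = f 1 s ∧ σ'.real 10 = f 2 s ∧ σ'.real 11 = f 3 s := by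
  obtain ⟨P, c, hP⟩ := (hf 0).pair (hf 1) 8 le_rfl
  obtain ⟨Q, c', hQ⟩ := (hf 2).pair (hf 3) 10 (by norm_num)
  refine ⟨.seq P Q, c + c', fun σ s hs => ?_⟩
  obtain ⟨σ₁, k₁, r₁, l₁, s₁, e₁, e₂, p₁⟩ := hP σ s hs
  obtain ⟨σ₂, k₂, r₂, l₂, s₂, e₃, e₄, p₂⟩ := hQ σ₁ s s₁
  exact ⟨σ₂, _, r₁.seq r₂, by omega, s₂, by rw [p₂ 8 (by norm_num), e₁],
    by rw [p₂ 9 (by norm_num), e₂], e₃, e₄⟩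

theorem Impl.set_F {f : Fin 4 → Mem → ℝ} (hf : ∀ c, RComp (f c)) :
    Impl fun s => { s with F := fun c => f c s } := by
  obtain ⟨P, c, hP⟩ := RComp.quad hf
  refine ⟨.seq P (.seq (.instr (.setReal 4 (.copy 8))) (.seq (.instr (.setReal 5 (.copy 9)))
    (.seq (.instr (.setReal 6 (.copy 10))) (.instr (.setReal 7 (.copy 11)))))), c + 4,
    fun σ s hs => ?_⟩
  obtain ⟨σ₁, k₁, r₁, l₁, h, e₀, e₁, e₂, e₃⟩ := hP σ s hs
  refine ⟨_, _, r₁.seq ((Run.instr _ _).seq ((Run.instr _ _).seq ((Run.instr _ _).seq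
    (Run.instr _ _)))), by omega, ?_⟩
  constructor
  case F =>
    intro c
    fin_cases c <;> simp [Instr.exec, RealRhs.eval, e₀, e₁, e₂, e₃]
  all_goals simp [Instr.exec, RealRhs.eval, h.n, h.a, h.b, h.m, h.k, h.d, h.bs, h.bt, h.best, h.D,
    h.x, h.y, h.t, h.S]

theorem Impl.set_result {f g h : Mem → ℝ} (hf : RComp f) (hg : RComp g) (hh : RComp h) :
    Impl fun s => { s with bs := f s, bt := g s, best := h s } := by
  obtain ⟨P, c, hP⟩ := RComp.quad (f := ![f, g, h, h]) fun c => by fin_cases c <;> assumption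
  refine ⟨.seq P (.seq (.instr (.setReal 0 (.copy 8))) (.seq (.instr (.setReal 1 (.copy 9)))
    (.instr (.setReal 2 (.copy 10))))), c + 3, fun σ s hs => ?_⟩
  obtain ⟨σ₁, k₁, r₁, l₁, h, e₀, e₁, e₂, -⟩ := hP σ s hs
  refine ⟨_, _, r₁.seq ((Run.instr _ _).seq ((Run.instr _ _).seq (Run.instr _ _))), by omega, ?_⟩
  simp only [Matrix.cons_val_zero, Matrix.cons_val_one, Matrix.cons_val] at e₀ e₁ e₂
  constructor
  case F =>
    intro c
    fin_cases c
    exacts [h.F 0, h.F 1, h.F 2, h.F 3]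
  all_goals simp [Instr.exec, RealRhs.eval, h.n, h.a, h.b, h.m, h.k, h.d, e₀, e₁, e₂, h.D,
    h.x, h.y, h.t, h.S]

theorem Impl.set_S {i : Mem → ℕ} (hi : NComp i) {f : Fin 4 → Mem → ℝ} (hf : ∀ c, RComp (f c)) :
    Impl fun s => { s with S := fun c => Function.update (s.S c) (i s) (f c s) } := by
  obtain ⟨P, c, hP⟩ := RComp.quad hf
  obtain ⟨Q, c', hQ⟩ := hi 8 le_rfl
  refine ⟨.seq P (.seq Q (.seq (.instr (.storeReal 3 8 8)) (.seq (.instr (.storeReal 4 8 9))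
    (.seq (.instr (.storeReal 5 8 10)) (.instr (.storeReal 6 8 11)))))), c + (c' + 4),
    fun σ s hs => ?_⟩
  obtain ⟨σ₁, k₁, r₁, l₁, s₁, e₀, e₁, e₂, e₃⟩ := hP σ s hs
  obtain ⟨σ₂, k₂, r₂, l₂, h, ei, -, q₂⟩ := hQ σ₁ s s₁
  refine ⟨_, _, r₁.seq (r₂.seq ((Run.instr _ _).seq ((Run.instr _ _).seq ((Run.instr _ _).seq
    (Run.instr _ _))))), by omega, ?_⟩
  have h0 : σ₂.realArr 3 = s.S 0 := h.S 0
  have h1 : σ₂.realArr 4 = s.S 1 := h.S 1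
  have h2 : σ₂.realArr 5 = s.S 2 := h.S 2
  have h3 : σ₂.realArr 6 = s.S 3 := h.S 3
  constructor
  case S =>
    intro c
    fin_cases c <;> simp [Instr.exec, e₀, e₁, e₂, e₃, q₂, ei, h0, h1, h2, h3,
      Function.update_of_ne]
  all_goals simp [Instr.exec, h.n, h.a, h.b, h.m, h.k, h.d, h.bs, h.bt, h.best, h.D, h.F,
    h.x, h.y, h.t]

/-! ### Conditions -/

theorem BComp.natLt {f g : Mem → ℕ} (hf : NComp f) (hg : NComp g) : BComp fun s => f s < g s := by
  intro F G hF hG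
  obtain ⟨P, c, hP⟩ := hf.pair hg 8 le_rfl
  obtain ⟨Q, c₁, hQ⟩ := hF
  obtain ⟨Q', c₂, hQ'⟩ := hG
  refine ⟨.seq P (.ite (.natLt 8 9) Q Q'), c + (c₁ + c₂ + 1), fun σ s hs => ?_⟩
  obtain ⟨σ₁, k₁, r₁, l₁, s₁, e₁, e₂, -⟩ := hP σ s hs
  by_cases h : f s < g s
  · obtain ⟨σ₂, k₂, r₂, l₂, s₂⟩ := hQ σ₁ s s₁
    exact ⟨_, _, r₁.seq (Run.iteTrue (by simpa [Test.Holds, e₁, e₂] using h) r₂), by omega,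
      by simpa [h] using s₂⟩
  · obtain ⟨σ₂, k₂, r₂, l₂, s₂⟩ := hQ' σ₁ s s₁
    exact ⟨_, _, r₁.seq (Run.iteFalse (by simpa [Test.Holds, e₁, e₂] using h) r₂), by omega,
      by simpa [h] using s₂⟩

theorem BComp.realLe {f g : Mem → ℝ} (hf : RComp f) (hg : RComp g) :
    BComp fun s => f s ≤ g s := by
  intro F G hF hG
  obtain ⟨P, c, hP⟩ := hf.pair hg 8 le_rfl
  obtain ⟨Q, c₁, hQ⟩ := hF
  obtain ⟨Q', c₂, hQ'⟩ := hG
  refine ⟨.seq P (.ite (.realLe 8 9) Q Q'), c + (c₁ + c₂ + 1), fun σ s hs => ?_⟩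
  obtain ⟨σ₁, k₁, r₁, l₁, s₁, e₁, e₂, -⟩ := hP σ s hs
  by_cases h : f s ≤ g s
  · obtain ⟨σ₂, k₂, r₂, l₂, s₂⟩ := hQ σ₁ s s₁
    exact ⟨_, _, r₁.seq (Run.iteTrue (by simpa [Test.Holds, e₁, e₂] using h) r₂), by omega,
      by simpa [h] using s₂⟩
  · obtain ⟨σ₂, k₂, r₂, l₂, s₂⟩ := hQ' σ₁ s s₁
    exact ⟨_, _, r₁.seq (Run.iteFalse (by simpa [Test.Holds, e₁, e₂] using h) r₂), by omega,
      by simpa [h] using s₂⟩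

theorem Impl.ite {p : Mem → Prop} [DecidablePred p] (hp : BComp p) {f g : Mem → Mem}
    (hf : Impl f) (hg : Impl g) : Impl fun s => if p s then f s else g s := by
  convert hp f g hf hg

theorem BComp.and {p q : Mem → Prop} (hp : BComp p) (hq : BComp q) :
    BComp fun s => p s ∧ q s := by
  intro F G hF hG
  convert hp _ _ (hq _ _ hF hG) hG using 2 with s
  by_cases h : p s <;> by_cases h' : q s <;> simp [h, h']

/-- The quantifier is unrolled into nested branchings, one per index; the index type is fixed, so
the cost stays constant. -/
theorem BComp.forall_fintype {ι : Type*} [Fintype ι] {p : ι → Mem → Prop}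
    (hp : ∀ i, BComp (p i)) : BComp fun s => ∀ i, p i s := by
  have key : ∀ l : List ι, BComp fun s => ∀ i ∈ l, p i s := by
    intro l
    induction l with
    | nil => intro F G hF _; simpa using hF
    | cons i l ih => simpa using (hp i).and ih
  simpa using key Finset.univ.toList

/-! ### Loops -/

/-- A loop whose body is performed in constant time and decreases a measure. -/
theorem Impl.loop {step : Mem → Mem} (hstep : Impl step) :
    ∃ (P : Program) (c : ℕ), ∀ (Inv : Mem → Prop) (Φ : Mem → ℕ),
      (∀ s, Inv s → s.d < s.n → Inv (step s) ∧ Φ (step s) < Φ s) →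
      ∀ σ s, Rep σ s → Inv s → ∃ σ' k s', Run P σ σ' k ∧ k ≤ c * Φ s + 1 ∧ Rep σ' s' ∧ Inv s' ∧
        ¬ s'.d < s'.n := by
  obtain ⟨P, c, hP⟩ := hstep
  -- Program and constant are fixed before `Inv` and `Φ`, since the invariant will depend on the
  -- trajectory and the program must not. The test compares `d` with `n` and adds one step per
  -- round.
  refine ⟨.loop (.natLt 5 0) P, c + 1, fun Inv Φ hInv => ?_⟩
  suffices H : ∀ N σ s, Φ s ≤ N → Rep σ s → Inv s → ∃ σ' k s', Run (.loop (.natLt 5 0) P) σ σ' k ∧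
      k ≤ (c + 1) * Φ s + 1 ∧ Rep σ' s' ∧ Inv s' ∧ ¬ s'.d < s'.n from
    fun σ s => H _ σ s le_rfl
  intro N
  induction N with
  | zero =>
    intro σ s hN hs hi
    have hd : ¬ s.d < s.n := fun h => by have := (hInv s hi h).2; omega
    exact ⟨σ, 1, s, Run.loopFalse (by simpa [Test.Holds, hs.d, hs.n] using hd), by omega, hs, hi,
      hd⟩
  | succ N ih =>
    intro σ s hN hs hi
    by_cases hd : s.d < s.n
    · obtain ⟨hi', hΦ⟩ := hInv s hi hd
      obtain ⟨σ₁, k₁, r₁, l₁, s₁⟩ := hP σ s hs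
      obtain ⟨σ₂, k₂, s', r₂, l₂, h₂⟩ := ih σ₁ _ (by omega) s₁ hi'
      refine ⟨σ₂, _, s', Run.loopTrue (by simpa [Test.Holds, hs.d, hs.n] using hd) r₁ r₂, ?_, h₂⟩
      calc k₁ + k₂ + 1 ≤ (c + 1) * (Φ (step s) + 1) + 1 := by rw [mul_add]; omega
        _ ≤ _ := by gcongr; exact hΦ
    · exact ⟨σ, 1, s, Run.loopFalse (by simpa [Test.Holds, hs.d, hs.n] using hd), by omega, hs, hi,
        hd⟩

end RealRAM

/-! ## Linear programs with two variables -/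

/-- From a feasible point one can move in a given direction until a constraint becomes tight. -/
theorem exists_tight_on_ray {ι : Type*} [Fintype ι] {A B C : ι → ℝ} {p q d e : ℝ}
    (hd : ∃ i, 0 < A i * d + B i * e) (h : ∀ i, A i * p + B i * q ≤ C i) :
    ∃ r, 0 ≤ r ∧ (∀ i, A i * (p + r * d) + B i * (q + r * e) ≤ C i) ∧
      ∃ i, 0 < A i * d + B i * e ∧ A i * (p + r * d) + B i * (q + r * e) = C i := by
  classical
  obtain ⟨j, hj⟩ := hd
  -- Ratio test: among the constraints whose left side grows along the ray, take the one reached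
  -- first.
  obtain ⟨i, hi, hmin⟩ := (Finset.univ.filter fun i => 0 < A i * d + B i * e).exists_min_image
    (fun i => (C i - (A i * p + B i * q)) / (A i * d + B i * e)) ⟨j, by simpa using hj⟩
  simp only [Finset.mem_filter, Finset.mem_univ, true_and] at hi hmin
  set r := (C i - (A i * p + B i * q)) / (A i * d + B i * e) with hr
  have hr0 : 0 ≤ r := div_nonneg (by linarith [h i]) hi.le
  refine ⟨r, hr0, fun l => ?_, i, hi, ?_⟩
  · rcases lt_or_ge 0 (A l * d + B l * e) with hl | hl
    · have := (le_div_iff₀ hl).1 (hmin l hl)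
      linarith
    · nlinarith [h l, mul_nonneg hr0 (neg_nonneg.2 hl)]
  · have : r * (A i * d + B i * e) = C i - (A i * p + B i * q) := div_mul_cancel₀ _ hi.ne'
    linarith

/-- The value of a linear objective at a feasible point of a bounded linear program is at most its
value at some feasible intersection point of two boundary lines. -/
theorem exists_vertex_ge {ι : Type*} [Fintype ι] {A B C : ι → ℝ} {p q : ℝ}
    (hb : ∀ d e : ℝ, d ≠ 0 ∨ e ≠ 0 → ∃ i, 0 < A i * d + B i * e)
    (h : ∀ i, A i * p + B i * q ≤ C i) (α β : ℝ) :
    ∃ k l u w, u = (C k * B l - C l * B k) / (A k * B l - A l * B k) ∧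
      w = (A k * C l - A l * C k) / (A k * B l - A l * B k) ∧
      (∀ i, A i * u + B i * w ≤ C i) ∧ α * p + β * q ≤ α * u + β * w := by
  -- Any nonzero direction that does not decrease the objective will do, because `hb` says that
  -- every ray is eventually blocked.
  obtain ⟨d, e, hde, hobj⟩ : ∃ d e : ℝ, (d ≠ 0 ∨ e ≠ 0) ∧ 0 ≤ α * d + β * e := by
    rcases le_total 0 α with hα | hα
    · exact ⟨1, 0, by simp, by simpa using hα⟩
    · exact ⟨-1, 0, by simp, by simpa using hα⟩
  obtain ⟨r, hr, hfeas, k, hk, hkt⟩ := exists_tight_on_ray (hb d e hde) h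
  -- Slide next along the boundary line of `k`, in the sense that does not decrease the objective.
  -- Constraint `k` stays tight until a second one becomes tight.
  obtain ⟨d', e', hpar, hne', hobj'⟩ : ∃ d' e' : ℝ,
      (d' = -B k ∧ e' = A k ∨ d' = B k ∧ e' = -A k) ∧ (d' ≠ 0 ∨ e' ≠ 0) ∧
        0 ≤ α * d' + β * e' := by
    have hne : A k ≠ 0 ∨ B k ≠ 0 := by
      by_contra! hc
      simp [hc.1, hc.2] at hk
    rcases le_total 0 (α * -B k + β * A k) with ho | ho
    · exact ⟨-B k, A k, .inl ⟨rfl, rfl⟩, by simpa using hne.symm, ho⟩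
    · exact ⟨B k, -A k, .inr ⟨rfl, rfl⟩, by simpa using hne.symm, by linarith⟩
  obtain ⟨r', hr', hfeas', l, hl, hlt⟩ := exists_tight_on_ray (hb d' e' hne') hfeas
  have hkt' : A k * (p + r * d + r' * d') + B k * (q + r * e + r' * e') = C k := by
    have : A k * d' + B k * e' = 0 := by
      rcases hpar with ⟨rfl, rfl⟩ | ⟨rfl, rfl⟩ <;> ring
    linear_combination hkt + r' * this
  -- The determinant is, up to sign, the rate at which constraint `l` grows along the boundary line
  -- of `k`, and this rate is positive.
  have hdet : A k * B l - A l * B k ≠ 0 := by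
    intro h0
    rcases hpar with ⟨rfl, rfl⟩ | ⟨rfl, rfl⟩ <;> linarith
  refine ⟨k, l, p + r * d + r' * d', q + r * e + r' * e', ?_, ?_, hfeas', ?_⟩
  · rw [eq_div_iff hdet]
    linear_combination B l * hkt' - B k * hlt
  · rw [eq_div_iff hdet]
    linear_combination A k * hlt - A l * hkt'
  · nlinarith [mul_nonneg hr hobj, mul_nonneg hr' hobj']

/-! ## Coverability by one square -/

/-- The four linear forms `x`, `-x`, `y`, `-y`. -/
def axisForm (c : Fin 4) (x y : ℝ) : ℝ := ![x, -x, y, -y] c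

/-- The index of the negative of a linear form. -/
def opp (c : Fin 4) : Fin 4 := ![1, 0, 3, 2] c

theorem opp_opp (c : Fin 4) : opp (opp c) = c := by revert c; decide

/-- The extent of the point `p` in the direction `c`. -/
def extent (c : Fin 4) (p : Plane) : ℝ := axisForm c (p 0) (p 1)

theorem extent_add_opp (c : Fin 4) (p : Plane) : extent c p + extent (opp c) p = 0 := by
  fin_cases c <;> simp [extent, axisForm, opp]

theorem extent_lineMap (c : Fin 4) (p q : Plane) (u : ℝ) :
    extent c (AffineMap.lineMap p q u) = extent c p + u * (extent c q - extent c p) := by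
  fin_cases c <;> simp [extent, axisForm, AffineMap.lineMap_apply] <;> ring

/-- The sum of an extent and an opposite extent is a difference of coordinates. If all these are at
most 1, the coordinatewise infima give the lower left corner of a covering square. -/
theorem isCoverable_one_iff {E : Set Plane} :
    IsCoverable 1 E ↔ ∀ c, ∀ p ∈ E, ∀ q ∈ E, extent c p + extent (opp c) q ≤ 1 := by
  constructor
  · rintro ⟨e, he⟩ c p hp q hq
    have mem : ∀ r ∈ E, r ∈ unitSquare (e 0) := fun r hr => by
      simpa using he hr
    have p0 := mem p hp 0
    have p1 := mem p hp 1
    have q0 := mem q hq 0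
    have q1 := mem q hq 1
    fin_cases c <;> simp [extent, axisForm, opp] <;> linarith
  · intro h
    rcases E.eq_empty_or_nonempty with rfl | hne
    · exact ⟨fun _ => 0, by simp⟩
    have key : ∀ d : Fin 2, ∀ p ∈ E, ∀ q ∈ E, p d - q d ≤ 1 := by
      intro d p hp q hq
      have h0 := h 0 p hp q hq
      have h2 := h 2 p hp q hq
      fin_cases d
      · simpa [extent, axisForm, opp, ← sub_eq_add_neg] using h0
      · simpa [extent, axisForm, opp, ← sub_eq_add_neg] using h2
    refine ⟨fun _ => WithLp.toLp 2 fun d => sInf ((fun p : Plane => p d) '' E), fun p hp => ?_⟩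
    simp only [Set.mem_iUnion, exists_const]
    intro d
    have hbdd : BddBelow ((fun p : Plane => p d) '' E) :=
      ⟨p d - 1, by rintro _ ⟨q, hq, rfl⟩; linarith [key d p hp q hq]⟩
    refine ⟨csInf_le hbdd ⟨p, hp, rfl⟩, ?_⟩
    have : p d - 1 ≤ sInf ((fun p : Plane => p d) '' E) :=
      le_csInf (hne.image _) (by rintro _ ⟨q, hq, rfl⟩; linarith [key d p hp q hq])
    change p d ≤ sInf ((fun p : Plane => p d) '' E) + 1
    linarith

/-! ## Trajectories -/

namespace Trajectory

variable {n : ℕ} (T : Trajectory n)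

/-- The `k`-th time, with the last time repeated forever. -/
def timeAt (k : ℕ) : ℝ := T.time ⟨min k (n - 1), by have := T.pos; omega⟩

/-- The `k`-th vertex, with the last vertex repeated forever. -/
def vertexAt (k : ℕ) : Plane := T.curve (T.timeAt k)

theorem timeAt_mono : Monotone T.timeAt := fun k l h =>
  T.strictMono_time.monotone (by simp only [Fin.mk_le_mk]; omega)

theorem timeAt_zero : T.timeAt 0 = T.startTime := by
  simp [timeAt, startTime]

theorem timeAt_of_ge {k : ℕ} (hk : n - 1 ≤ k) : T.timeAt k = T.endTime := by
  simp [timeAt, endTime, hk]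

theorem timeAt_lt {k : ℕ} (hk : k + 1 < n) : T.timeAt k < T.timeAt (k + 1) :=
  T.strictMono_time (by simp only [Fin.mk_lt_mk]; omega)

theorem startTime_le (k : ℕ) : T.startTime ≤ T.timeAt k :=
  T.timeAt_zero ▸ T.timeAt_mono (Nat.zero_le k)

theorem le_endTime (k : ℕ) : T.timeAt k ≤ T.endTime := by
  rw [← T.timeAt_of_ge (le_max_right k (n - 1))]
  exact T.timeAt_mono (le_max_left _ _)

/-- The case `l = k` is the degenerate edge before vertex 0, where `0 - 1 = 0`. The edge after the
last vertex degenerates because `timeAt` is clamped, so windows at either end need no special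
treatment. -/
theorem curve_lineMap {k l : ℕ} (h : l = k ∨ l = k + 1) {u : ℝ} (hu : u ∈ Set.Icc (0 : ℝ) 1) :
    T.curve (AffineMap.lineMap (T.timeAt k) (T.timeAt l) u) =
      AffineMap.lineMap (T.vertexAt k) (T.vertexAt l) u := by
  rcases h with rfl | rfl
  · simp [vertexAt]
  · by_cases hk : k + 1 < n
    · have h1 : T.timeAt k = T.time ⟨k, by omega⟩ := by
        unfold timeAt; congr 2; omega
      have h2 : T.timeAt (k + 1) = T.time ⟨k + 1, hk⟩ := by
        unfold timeAt; congr 2; omega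
      rw [vertexAt, vertexAt, h1, h2]
      exact T.affine_edge k hk u hu
    · rw [vertexAt, vertexAt, T.timeAt_of_ge (by omega : n - 1 ≤ k),
        T.timeAt_of_ge (by omega : n - 1 ≤ k + 1)]
      simp

theorem exists_lineMap {p q s : ℝ} (hp : p ≤ s) (hq : s ≤ q) :
    ∃ u ∈ Set.Icc (0 : ℝ) 1, AffineMap.lineMap p q u = s := by
  have : s ∈ segment ℝ p q := by rw [segment_eq_Icc (hp.trans hq)]; exact ⟨hp, hq⟩
  rwa [segment_eq_image_lineMap] at this

theorem lineMap_mono {p q : ℝ} (h : p ≤ q) : Monotone (AffineMap.lineMap p q : ℝ → ℝ) := by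
  intro u w huw
  simp only [AffineMap.lineMap_apply_module', smul_eq_mul]
  nlinarith

/-- On an edge, the length is proportional to the parameter. -/
theorem length_lineMap {k l : ℕ} (h : l = k ∨ l = k + 1) {u w : ℝ} (hu : 0 ≤ u) (huw : u ≤ w)
    (hw : w ≤ 1) :
    T.length (AffineMap.lineMap (T.timeAt k) (T.timeAt l) u)
      (AffineMap.lineMap (T.timeAt k) (T.timeAt l) w) =
      ENNReal.ofReal ((w - u) * dist (T.vertexAt k) (T.vertexAt l)) := by
  have hle : T.timeAt k ≤ T.timeAt l := T.timeAt_mono (by omega)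
  rcases hle.eq_or_lt with heq | hlt
  · rw [vertexAt, vertexAt, heq, length]
    simp only [AffineMap.lineMap_same_apply, Set.Icc_self, dist_self, mul_zero, ENNReal.ofReal_zero]
    exact eVariationOn.subsingleton _ Set.subsingleton_singleton
  have hd : 0 < T.timeAt l - T.timeAt k := sub_pos.2 hlt
  set g : ℝ → ℝ := fun x => (x - T.timeAt k) / (T.timeAt l - T.timeAt k) with hg
  have hgl : ∀ r, g (AffineMap.lineMap (T.timeAt k) (T.timeAt l) r) = r := fun r => by
    simp only [hg, AffineMap.lineMap_apply_module', smul_eq_mul]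
    field_simp
    ring
  have hlg : ∀ x, AffineMap.lineMap (T.timeAt k) (T.timeAt l) (g x) = x := fun x => by
    simp only [hg, AffineMap.lineMap_apply_module', smul_eq_mul]
    field_simp
    ring
  have hgm : Monotone g := fun x y hxy => by
    simp only [hg]
    gcongr
  set s := AffineMap.lineMap (T.timeAt k) (T.timeAt l) u
  set t := AffineMap.lineMap (T.timeAt k) (T.timeAt l) w
  have hst : s ≤ t := lineMap_mono hle huw
  have hcurve : ∀ r ∈ Set.Icc (0 : ℝ) 1, T.curve (AffineMap.lineMap (T.timeAt k) (T.timeAt l) r) =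
    AffineMap.lineMap (T.vertexAt k) (T.vertexAt l) r := fun r hr => T.curve_lineMap h hr
  have heq : Set.EqOn T.curve (AffineMap.lineMap (T.vertexAt k) (T.vertexAt l) ∘ g)
      (Set.Icc s t) := by
    intro x hx
    have h1 := hgm hx.1
    have h2 := hgm hx.2
    rw [hgl] at h1 h2
    rw [Function.comp, ← hcurve _ ⟨by linarith, by linarith⟩, hlg]
  rw [length]
  -- Above, the curve is a Lipschitz affine map composed with the monotone `g`, whose variation is
  -- `w - u`. Below, the variation is at least the distance between the end points.
  apply le_antisymm
  · rw [eVariationOn.congr heq]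
    have h1 := ((lipschitzWith_lineMap (𝕜 := ℝ) (T.vertexAt k)
      (T.vertexAt l)).lipschitzOnWith (s := Set.univ)).comp_eVariationOn_le
      (Set.mapsTo_univ g (Set.Icc s t))
    refine h1.trans ?_
    have h2 := (hgm.monotoneOn (Set.Icc s t)).eVariationOn_eq (Set.left_mem_Icc.2 hst)
      (Set.right_mem_Icc.2 hst)
    rw [Set.inter_self, hgl, hgl] at h2
    rw [h2, ENNReal.ofReal_mul (sub_nonneg.2 huw), ← edist_dist, edist_nndist, mul_comm]
  · refine le_trans ?_ (eVariationOn.edist_le T.curve (Set.left_mem_Icc.2 hst)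
      (Set.right_mem_Icc.2 hst))
    rw [hcurve _ ⟨hu, huw.trans hw⟩, hcurve _ ⟨hu.trans huw, hw⟩, edist_dist, dist_lineMap_lineMap,
      dist_comm u, Real.dist_eq, abs_of_nonneg (by linarith)]

/-! ### Lengths as differences of arc length -/

theorem length_add {s t r : ℝ} (hst : s ≤ t) (htr : t ≤ r) :
    T.length s t + T.length t r = T.length s r := by
  simpa [length] using eVariationOn.Icc_add_Icc T.curve hst htr (Set.mem_univ t)

theorem length_start_ne_top (k : ℕ) : T.length T.startTime (T.timeAt k) ≠ ⊤ := by
  induction k with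
  | zero =>
    rw [T.timeAt_zero, length, Set.Icc_self,
      eVariationOn.subsingleton _ Set.subsingleton_singleton]
    exact ENNReal.zero_ne_top
  | succ k ih =>
    have := T.length_lineMap (Or.inr rfl : k + 1 = k ∨ k + 1 = k + 1) le_rfl zero_le_one le_rfl
    rw [AffineMap.lineMap_apply_zero, AffineMap.lineMap_apply_one] at this
    rw [← T.length_add (T.startTime_le k) (T.timeAt_mono k.le_succ), this]
    exact ENNReal.add_ne_top.2 ⟨ih, ENNReal.ofReal_ne_top⟩

/-- The length of the trajectory up to the time `s`. -/
noncomputable def arc (s : ℝ) : ℝ := (T.length T.startTime s).toReal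

theorem length_ne_top {s : ℝ} (hs : s ≤ T.endTime) : T.length T.startTime s ≠ ⊤ := by
  refine ne_top_of_le_ne_top (T.length_start_ne_top (n - 1)) (eVariationOn.mono _ ?_)
  rw [T.timeAt_of_ge le_rfl]
  exact Set.Icc_subset_Icc_right hs

/-- Lengths up to the last time are finite, so additivity can be subtracted. From here on, lengths
are compared as differences of one real function. -/
theorem length_eq_arc {s t : ℝ} (hs : T.startTime ≤ s) (hst : s ≤ t) (ht : t ≤ T.endTime) :
    T.length s t = ENNReal.ofReal (T.arc t - T.arc s) ∧ T.arc s ≤ T.arc t := by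
  have h := T.length_add hs hst
  have ht' := T.length_ne_top ht
  have hs' := T.length_ne_top (hst.trans ht)
  have hst' : T.length s t ≠ ⊤ := fun hc => ht' (by rw [← h, hc, add_top])
  have h2 : T.arc t = T.arc s + (T.length s t).toReal := by
    rw [arc, ← h, ENNReal.toReal_add hs' hst', arc]
  refine ⟨?_, by rw [h2]; linarith [ENNReal.toReal_nonneg (a := T.length s t)]⟩
  rw [h2, add_sub_cancel_left, ENNReal.ofReal_toReal hst']

theorem arc_mono {s t : ℝ} (hs : T.startTime ≤ s) (hst : s ≤ t) (ht : t ≤ T.endTime) :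
    T.arc s ≤ T.arc t := (T.length_eq_arc hs hst ht).2

theorem arc_lineMap {k l : ℕ} (h : l = k ∨ l = k + 1) {u : ℝ} (hu : u ∈ Set.Icc (0 : ℝ) 1) :
    T.arc (AffineMap.lineMap (T.timeAt k) (T.timeAt l) u) =
      T.arc (T.timeAt k) + u * dist (T.vertexAt k) (T.vertexAt l) := by
  have hle : T.timeAt k ≤ T.timeAt l := T.timeAt_mono (by omega)
  have h1 := T.length_lineMap h le_rfl hu.1 hu.2
  have h2 := lineMap_mono hle hu.1
  have h3 := lineMap_mono hle hu.2
  rw [AffineMap.lineMap_apply_zero] at h1 h2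
  rw [AffineMap.lineMap_apply_one] at h3
  have h4 := T.length_eq_arc (T.startTime_le k) h2 (h3.trans (T.le_endTime l))
  rw [h4.1, ENNReal.ofReal_eq_ofReal_iff (by linarith)
    (mul_nonneg (by linarith [hu.1]) dist_nonneg)] at h1
  linarith

theorem dist_vertexAt (k l : ℕ) : dist (T.vertexAt k) (T.vertexAt l) =
    √((T.vertexAt k 0 - T.vertexAt l 0) * (T.vertexAt k 0 - T.vertexAt l 0) +
      (T.vertexAt k 1 - T.vertexAt l 1) * (T.vertexAt k 1 - T.vertexAt l 1)) := by
  rw [EuclideanSpace.dist_eq]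
  simp [Real.dist_eq, sq]

/-- On an edge, the extent at an intermediate time is bounded by the extents at the ends. -/
theorem extent_le_of_edge {k l : ℕ} (h : l = k ∨ l = k + 1) {p q r : ℝ}
    (hp : T.timeAt k ≤ p) (hpr : p ≤ r) (hrq : r ≤ q) (hq : q ≤ T.timeAt l) {c : Fin 4} {z : ℝ}
    (h₁ : extent c (T.curve p) ≤ z) (h₂ : extent c (T.curve q) ≤ z) :
    extent c (T.curve r) ≤ z := by
  obtain ⟨u, hu, rfl⟩ := exists_lineMap hp (hpr.trans (hrq.trans hq))
  obtain ⟨w, hw, rfl⟩ := exists_lineMap (hp.trans (hpr.trans hrq)) hq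
  obtain ⟨v, hv, rfl⟩ := exists_lineMap hpr hrq
  have hc : AffineMap.lineMap (AffineMap.lineMap (T.timeAt k) (T.timeAt l) u)
      (AffineMap.lineMap (T.timeAt k) (T.timeAt l) w) v =
      AffineMap.lineMap (T.timeAt k) (T.timeAt l) (u + v * (w - u)) := by
    simp only [AffineMap.lineMap_apply_module', smul_eq_mul]
    ring
  obtain ⟨hu0, hu1⟩ := hu
  obtain ⟨hw0, hw1⟩ := hw
  obtain ⟨hv0, hv1⟩ := hv
  have hr : u + v * (w - u) ∈ Set.Icc (0 : ℝ) 1 := ⟨by nlinarith, by nlinarith⟩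
  rw [T.curve_lineMap h ⟨hu0, hu1⟩, extent_lineMap] at h₁
  rw [T.curve_lineMap h ⟨hw0, hw1⟩, extent_lineMap] at h₂
  rw [hc, T.curve_lineMap h hr, extent_lineMap]
  nlinarith [mul_le_mul_of_nonneg_left h₁ (sub_nonneg.2 hv1), mul_le_mul_of_nonneg_left h₂ hv0]

/-- Between two vertices the extent is bounded by the extents of the vertices. -/
theorem extent_le_of_vertices {c : Fin 4} {z : ℝ} {a b : ℕ} (hab : a ≤ b)
    (h : ∀ k, a ≤ k → k ≤ b → extent c (T.vertexAt k) ≤ z) {r : ℝ}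
    (ha : T.timeAt a ≤ r) (hb : r ≤ T.timeAt b) : extent c (T.curve r) ≤ z := by
  induction b, hab using Nat.le_induction with
  | base => rw [le_antisymm hb ha]; exact h a le_rfl le_rfl
  | succ b hab ih =>
    rcases le_total r (T.timeAt b) with hr | hr
    · exact ih (fun k h1 h2 => h k h1 (by omega)) hr
    · exact T.extent_le_of_edge (Or.inr rfl) le_rfl hr hb le_rfl (h b hab (by omega))
        (h (b + 1) (by omega) le_rfl)

/-- The extents of a subtrajectory are those of its ends and the vertices between. -/
theorem extent_trace_le_iff {c : Fin 4} {z : ℝ} {a b : ℕ} (hab : a ≤ b) {s t : ℝ}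
    (hs : T.timeAt (a - 1) ≤ s) (hsa : s ≤ T.timeAt a) (hbt : T.timeAt b ≤ t)
    (ht : t ≤ T.timeAt (b + 1)) :
    (∀ p ∈ T.trace s t, extent c p ≤ z) ↔ extent c (T.curve s) ≤ z ∧ extent c (T.curve t) ≤ z ∧
      ∀ k, a ≤ k → k ≤ b → extent c (T.vertexAt k) ≤ z := by
  have hτ := T.timeAt_mono hab
  constructor
  · intro h
    refine ⟨h _ ⟨s, ⟨le_rfl, by linarith⟩, rfl⟩, h _ ⟨t, ⟨by linarith, le_rfl⟩, rfl⟩,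
      fun k hk hk' => h _ ⟨_, ⟨?_, ?_⟩, rfl⟩⟩
    · exact hsa.trans (T.timeAt_mono hk)
    · exact (T.timeAt_mono hk').trans hbt
  · rintro ⟨h1, h2, h3⟩ _ ⟨r, ⟨hr, hr'⟩, rfl⟩
    rcases le_total r (T.timeAt a) with ha | ha
    · exact T.extent_le_of_edge (k := a - 1) (l := a) (by omega) hs hr ha le_rfl h1
        (h3 a le_rfl hab)
    rcases le_total r (T.timeAt b) with hb | hb
    · exact T.extent_le_of_vertices hab h3 ha hb
    · exact T.extent_le_of_edge (Or.inr rfl) le_rfl hb hr' ht (h3 b hab le_rfl) h2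

/-- Any number bounding the extents in the direction `c` of the vertices `a, …, b` is at least `M`,
and `M` is the least such bound. -/
def IsWindowMax (c : Fin 4) (a b : ℕ) (M : ℝ) : Prop :=
  ∀ z, M ≤ z ↔ ∀ k, a ≤ k → k ≤ b → extent c (T.vertexAt k) ≤ z

/-! ### Window maxima and coverability -/

variable {T} {c : Fin 4} {a b m : ℕ} {M M' : ℝ}

theorem isWindowMax_self : T.IsWindowMax c a a (extent c (T.vertexAt a)) := fun _ =>
  ⟨fun h _ h1 h2 => (le_antisymm h1 h2) ▸ h, fun h => h a le_rfl le_rfl⟩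

theorem IsWindowMax.max (h : T.IsWindowMax c a m M) (h' : T.IsWindowMax c m b M') (ha : a ≤ m)
    (hb : m ≤ b) : T.IsWindowMax c a b (max M M') := by
  intro z
  rw [max_le_iff, h, h']
  refine ⟨fun ⟨h1, h2⟩ k hk hk' => ?_, fun h => ⟨fun k h1 h2 => h k h1 (by omega),
    fun k h1 h2 => h k (by omega) h2⟩⟩
  rcases le_total k m with hkm | hkm
  exacts [h1 k hk hkm, h2 k hkm hk']

theorem IsWindowMax.snoc (h : T.IsWindowMax c a b M) (hab : a ≤ b) :
    T.IsWindowMax c a (b + 1) (Max.max M (extent c (T.vertexAt (b + 1)))) := fun z => by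
  rw [max_le_iff, h]
  refine ⟨fun ⟨h1, h2⟩ k hk hk' => ?_, fun h => ⟨fun k h1 h2 => h k h1 (by omega),
    h _ (by omega) le_rfl⟩⟩
  rcases Nat.le_succ_iff.1 hk' with hkm | rfl
  exacts [h1 k hk hkm, h2]

theorem IsWindowMax.cons (h : T.IsWindowMax c (a + 1) b M) (hab : a ≤ b) :
    T.IsWindowMax c a b (Max.max M (extent c (T.vertexAt a))) := fun z => by
  rw [max_le_iff, h]
  refine ⟨fun ⟨h1, h2⟩ k hk hk' => ?_, fun h => ⟨fun k h1 h2 => h k (by omega) h2,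
    h _ le_rfl hab⟩⟩
  rcases hk.eq_or_lt with rfl | hkm
  exacts [h2, h1 k hkm hk']

/-- Extents over the trace are extremal at the two ends or at window vertices. It therefore suffices
to compare end with end, each end with the window, and the window with itself; both orders occur
because `c` also runs over opposite directions. -/
theorem isCoverable_trace_iff {M : Fin 4 → ℝ} (hM : ∀ c, T.IsWindowMax c a b (M c)) (hab : a ≤ b)
    {s t : ℝ} (hs : T.timeAt (a - 1) ≤ s) (hsa : s ≤ T.timeAt a) (hbt : T.timeAt b ≤ t)
    (ht : t ≤ T.timeAt (b + 1)) :
    IsCoverable 1 (T.trace s t) ↔ ∀ c,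
      extent c (T.curve s) + extent (opp c) (T.curve t) ≤ 1 ∧
      extent c (T.curve s) + M (opp c) ≤ 1 ∧
      extent c (T.curve t) + M (opp c) ≤ 1 ∧ M c + M (opp c) ≤ 1 := by
  rw [isCoverable_one_iff]
  have hτ := T.timeAt_mono hab
  constructor
  · intro h c
    have hs' : T.curve s ∈ T.trace s t := ⟨s, ⟨le_rfl, by linarith⟩, rfl⟩
    have ht' : T.curve t ∈ T.trace s t := ⟨t, ⟨by linarith, le_rfl⟩, rfl⟩
    have hv : ∀ k, a ≤ k → k ≤ b → T.vertexAt k ∈ T.trace s t := fun k h1 h2 =>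
      ⟨_, ⟨hsa.trans (T.timeAt_mono h1), (T.timeAt_mono h2).trans hbt⟩, rfl⟩
    have key : ∀ p ∈ T.trace s t, extent c p + M (opp c) ≤ 1 := fun p hp => by
      rw [← le_sub_iff_add_le', hM]
      exact fun k h1 h2 => by linarith [h c p hp _ (hv k h1 h2)]
    refine ⟨h c _ hs' _ ht', key _ hs', key _ ht', ?_⟩
    rw [← le_sub_iff_add_le, hM]
    exact fun k h1 h2 => by linarith [key _ (hv k h1 h2)]
  · intro h c p hp q hq
    have hw : ∀ c k, a ≤ k → k ≤ b → extent c (T.vertexAt k) ≤ M c := fun c => (hM c _).1 le_rfl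
    obtain ⟨h1, h2, h3, h4⟩ := h c
    obtain ⟨h1', h2', h3', -⟩ := h (opp c)
    rw [opp_opp] at h1' h2' h3'
    have e1 := extent_add_opp c (T.curve s)
    have e2 := extent_add_opp c (T.curve t)
    -- The point `q` is first reduced to the ends and window vertices for a fixed bound `e`;
    -- afterwards `p` is reduced in the same way.
    have aux : ∀ e : ℝ, e + extent (opp c) (T.curve s) ≤ 1 →
        e + extent (opp c) (T.curve t) ≤ 1 → e + M (opp c) ≤ 1 →
        e ≤ 1 - extent (opp c) q := by
      intro e hes het heM
      rw [le_sub_comm]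
      revert q
      rw [T.extent_trace_le_iff hab hs hsa hbt ht]
      exact ⟨by linarith, by linarith, fun l hl hl' => by linarith [hw (opp c) l hl hl']⟩
    rw [← le_sub_iff_add_le]
    revert p
    rw [T.extent_trace_le_iff hab hs hsa hbt ht]
    exact ⟨aux _ (by linarith) (by linarith) (by linarith),
      aux _ (by linarith) (by linarith) (by linarith), fun k hk hk' => by
        have := hw c k hk hk'
        exact aux _ (by linarith) (by linarith) (by linarith)⟩

end Trajectory

/-! ## The algorithm

A window of consecutive vertices `a, …, b` contained in a unit square moves along the trajectory. For
each position the longest 1-coverable subtrajectory starting on the edge before `a` and ending on the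
edge after `b` is found by solving a linear program of constant size. The extents of the window are
the maxima of `S c a`, the extent of the vertices `a, …, m`, and `F c`, that of `m, …, b`; the arrays
`S c` are recomputed, from `m` downwards, when `a` has passed `m`. -/

namespace RealRAM

namespace Mem

variable (s : Mem)

/-- The extent of a vertex. -/
def ext (c : Fin 4) (k : ℕ) : ℝ := axisForm c (s.x k) (s.y k)

/-- The successor of `b`, but at most `n - 1`. -/
def next : ℕ := s.n - 1 - (s.n - 1 - (s.b + 1))

/-- The distance between two vertices. -/
noncomputable def edge (k l : ℕ) : ℝ :=
  √((s.x k - s.x l) * (s.x k - s.x l) + (s.y k - s.y l) * (s.y k - s.y l))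

/-- The extent of the window. -/
noncomputable def top (c : Fin 4) : ℝ := max (s.S c s.a) (s.F c)

/-- The coefficients of the first variable: the constraints of index `(0, c)` bound the variables,
those of index `(1, c)` and `(2, c)` relate the starting and the end point to the window, those of
index `(3, c)` relate the starting point to the end point. -/
def coefA (i : Fin 4 × Fin 4) : ℝ :=
  ![![1, -1, 0, 0] i.2, s.ext i.2 s.a - s.ext i.2 (s.a - 1), 0,
    s.ext i.2 s.a - s.ext i.2 (s.a - 1)] i.1

/-- The coefficients of the second variable. -/
def coefB (i : Fin 4 × Fin 4) : ℝ :=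
  ![![0, 0, 1, -1] i.2, 0, s.ext i.2 s.next - s.ext i.2 s.b,
    s.ext (opp i.2) s.next - s.ext (opp i.2) s.b] i.1

/-- The right-hand sides. -/
noncomputable def coefC (i : Fin 4 × Fin 4) : ℝ :=
  ![![1, 0, 1, 0] i.2, 1 - s.top (opp i.2) - s.ext i.2 (s.a - 1),
    1 - s.top (opp i.2) - s.ext i.2 s.b, 1 - s.ext i.2 (s.a - 1) - s.ext (opp i.2) s.b] i.1

def Feasible (u w : ℝ) : Prop := ∀ i, s.coefA i * u + s.coefB i * w ≤ s.coefC i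

/-- The length of the subtrajectory with parameters `u` and `w`. -/
noncomputable def value (u w : ℝ) : ℝ :=
  s.D + (1 - u) * s.edge (s.a - 1) s.a + w * s.edge s.b s.next

def startAt (u : ℝ) : ℝ := s.t (s.a - 1) + u * (s.t s.a - s.t (s.a - 1))

def endAt (w : ℝ) : ℝ := s.t s.b + w * (s.t s.next - s.t s.b)

/-- The intersection point of the boundary lines of two constraints, first coordinate. -/
noncomputable def crossU (p : (Fin 4 × Fin 4) × (Fin 4 × Fin 4)) : ℝ :=
  (s.coefC p.1 * s.coefB p.2 - s.coefC p.2 * s.coefB p.1) /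
    (s.coefA p.1 * s.coefB p.2 - s.coefA p.2 * s.coefB p.1)

/-- The intersection point of the boundary lines of two constraints, second coordinate. -/
noncomputable def crossW (p : (Fin 4 × Fin 4) × (Fin 4 × Fin 4)) : ℝ :=
  (s.coefA p.1 * s.coefC p.2 - s.coefA p.2 * s.coefC p.1) /
    (s.coefA p.1 * s.coefB p.2 - s.coefA p.2 * s.coefB p.1)

open Classical in
/-- Compare the candidate given by two constraints with the best subtrajectory so far. -/
noncomputable def improve (p : (Fin 4 × Fin 4) × (Fin 4 × Fin 4)) : Mem :=
  -- For parallel boundary lines the quotients are 0 by convention. This is harmless, since a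
  -- candidate counts only if it is feasible.
  if s.Feasible (s.crossU p) (s.crossW p) then
    if s.value (s.crossU p) (s.crossW p) ≤ s.best then s
    else { s with
      bs := s.startAt (s.crossU p)
      bt := s.endAt (s.crossW p)
      best := s.value (s.crossU p) (s.crossW p) }
  else s

/-- Solve the linear program. -/
noncomputable def solve : Mem :=
  (Finset.univ : Finset ((Fin 4 × Fin 4) × (Fin 4 × Fin 4))).toList.foldl improve s

/-- Move the end of the window. -/
noncomputable def push : Mem :=
  { s with
    F := fun c => max (s.F c) (s.ext c (s.b + 1))
    D := s.D + s.edge s.b (s.b + 1)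
    b := s.b + 1 }

/-- Move the start of the window, keeping it nonempty. -/
noncomputable def shrink : Mem :=
  -- A one-vertex window moves as a whole; its length `D` is 0 before and after.
  if s.b < s.a + 1 then { s with a := s.a + 1, b := s.b + 1 }
  else { s with D := s.D - s.edge s.a (s.a + 1), a := s.a + 1 }

/-- Start the recomputation of the arrays `S c`. -/
def restart : Mem :=
  { s with
    S := fun c => Function.update (s.S c) s.b (s.ext c s.b)
    F := fun c => s.ext c s.b
    m := s.b
    k := s.b }

/-- Continue the recomputation of the arrays `S c`. -/
noncomputable def rebuild : Mem :=
  { s with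
    S := fun c => Function.update (s.S c) (s.k - 1) (max (s.S c s.k) (s.ext c (s.k - 1)))
    k := s.k - 1 }

/-- Once `a` has passed `m`, the suffix maxima concern only vertices that have left the window, so
the pivot jumps to `b`. -/
def restartIfNeeded : Mem := if s.m < s.a then s.restart else s

open Classical in
/-- Move the window. -/
noncomputable def advance : Mem :=
  if s.b + 1 < s.n then
    if ∀ c, max (s.top c) (s.ext c (s.b + 1)) +
        max (s.top (opp c)) (s.ext (opp c) (s.b + 1)) ≤ 1 then s.push
    else s.shrink.restartIfNeeded
  -- `d` is the termination flag: the loop runs while `d < n`.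
  else { s with d := s.n }

/-- Rebuilding fills one cell per iteration instead of running an inner loop, so a single loop with
a constant-time body suffices. -/
noncomputable def step : Mem := if s.a < s.k then s.rebuild else s.solve.advance

noncomputable def init : Mem :=
  { s with
    S := fun c => Function.update (s.S c) 0 (s.ext c 0)
    F := fun c => s.ext c 0
    bs := s.t 0
    bt := s.t 0
    best := 0 }

end Mem

/-! ### The algorithm runs in constant time per step -/

theorem RComp.axisForm {f g : Mem → ℝ} (hf : RComp f) (hg : RComp g) (c : Fin 4) :
    RComp fun s => axisForm c (f s) (g s) := by
  fin_cases c
  exacts [hf, hf.neg, hg, hg.neg]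

theorem RComp.ext {i : Mem → ℕ} (hi : NComp i) (c : Fin 4) : RComp fun s => s.ext c (i s) :=
  (RComp.x hi).axisForm (RComp.y hi) c

theorem NComp.next : NComp Mem.next :=
  (NComp.n.sub (.const 1)).sub ((NComp.n.sub (.const 1)).sub (NComp.b.add (.const 1)))

theorem NComp.prev : NComp fun s => s.a - 1 := NComp.a.sub (.const 1)

theorem NComp.b_succ : NComp fun s => s.b + 1 := NComp.b.add (.const 1)

theorem NComp.a_succ : NComp fun s => s.a + 1 := NComp.a.add (.const 1)

theorem RComp.edge {i j : Mem → ℕ} (hi : NComp i) (hj : NComp j) :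
    RComp fun s => s.edge (i s) (j s) :=
  ((((RComp.x hi).sub (RComp.x hj)).mul ((RComp.x hi).sub (RComp.x hj))).add
    (((RComp.y hi).sub (RComp.y hj)).mul ((RComp.y hi).sub (RComp.y hj)))).sqrt

theorem RComp.top (c : Fin 4) : RComp fun s => s.top c := (RComp.S .a c).max (.F c)

theorem RComp.coefA (i : Fin 4 × Fin 4) : RComp fun s => s.coefA i := by
  obtain ⟨i, c⟩ := i
  fin_cases i
  · fin_cases c
    exacts [.one, RComp.one.neg, .zero, .zero]
  exacts [(RComp.ext .a c).sub (.ext .prev c), .zero, (RComp.ext .a c).sub (.ext .prev c)]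

theorem RComp.coefB (i : Fin 4 × Fin 4) : RComp fun s => s.coefB i := by
  obtain ⟨i, c⟩ := i
  fin_cases i
  · fin_cases c
    exacts [.zero, .zero, .one, RComp.one.neg]
  exacts [.zero, (RComp.ext .next c).sub (.ext .b c),
    (RComp.ext .next (opp c)).sub (.ext .b (opp c))]

theorem RComp.coefC (i : Fin 4 × Fin 4) : RComp fun s => s.coefC i := by
  obtain ⟨i, c⟩ := i
  fin_cases i
  · fin_cases c
    exacts [.one, .zero, .one, .zero]
  exacts [(RComp.one.sub (.top (opp c))).sub (.ext .prev c),
    (RComp.one.sub (.top (opp c))).sub (.ext .b c),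
    (RComp.one.sub (.ext .prev c)).sub (.ext .b (opp c))]

theorem BComp.feasible {u w : Mem → ℝ} (hu : RComp u) (hw : RComp w) :
    BComp fun s => s.Feasible (u s) (w s) :=
  .forall_fintype fun i => .realLe (((RComp.coefA i).mul hu).add ((RComp.coefB i).mul hw)) (.coefC i)

theorem RComp.value {u w : Mem → ℝ} (hu : RComp u) (hw : RComp w) :
    RComp fun s => s.value (u s) (w s) :=
  (RComp.D.add ((RComp.one.sub hu).mul (.edge .prev .a))).add (hw.mul (.edge .b .next))

theorem RComp.startAt {u : Mem → ℝ} (hu : RComp u) : RComp fun s => s.startAt (u s) :=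
  (RComp.t .prev).add (hu.mul ((RComp.t .a).sub (.t .prev)))

theorem RComp.endAt {w : Mem → ℝ} (hw : RComp w) : RComp fun s => s.endAt (w s) :=
  (RComp.t .b).add (hw.mul ((RComp.t .next).sub (.t .b)))

theorem RComp.crossU (p) : RComp fun s => s.crossU p :=
  (((RComp.coefC p.1).mul (.coefB p.2)).sub ((RComp.coefC p.2).mul (.coefB p.1))).div
    (((RComp.coefA p.1).mul (.coefB p.2)).sub ((RComp.coefA p.2).mul (.coefB p.1)))

theorem RComp.crossW (p) : RComp fun s => s.crossW p :=
  (((RComp.coefA p.1).mul (.coefC p.2)).sub ((RComp.coefA p.2).mul (.coefC p.1))).div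
    (((RComp.coefA p.1).mul (.coefB p.2)).sub ((RComp.coefA p.2).mul (.coefB p.1)))

open Classical in
theorem Impl.improve (p) : Impl fun s => s.improve p :=
  .ite (.feasible (.crossU p) (.crossW p))
    (.ite (.realLe (.value (.crossU p) (.crossW p)) .best) .id
      (.set_result (.startAt (.crossU p)) (.endAt (.crossW p)) (.value (.crossU p) (.crossW p)))) .id

theorem Impl.solve : Impl Mem.solve := .foldl Impl.improve _

theorem Impl.push : Impl Mem.push :=
  -- `F` and `D` are assigned before `b`, since their new values refer to the old `b`.
  (Impl.set_F fun c => (RComp.F c).max (.ext .b_succ c)).comp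
    ((Impl.set_D (RComp.D.add (.edge .b .b_succ))).comp (.set_b .b_succ))

theorem Impl.shrink : Impl Mem.shrink :=
  Impl.ite (.natLt .b .a_succ) ((Impl.set_a .a_succ).comp (.set_b .b_succ))
    ((Impl.set_D (RComp.D.sub (.edge .a .a_succ))).comp (.set_a .a_succ))

theorem Impl.restart : Impl Mem.restart :=
  (Impl.set_S .b fun c => .ext .b c).comp ((Impl.set_F fun c => .ext .b c).comp
    ((Impl.set_m .b).comp (.set_k .b)))

theorem Impl.rebuild : Impl Mem.rebuild :=
  (Impl.set_S (NComp.k.sub (.const 1)) fun c =>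
    (RComp.S .k c).max (.ext (NComp.k.sub (.const 1)) c)).comp (.set_k (NComp.k.sub (.const 1)))

theorem Impl.restartIfNeeded : Impl Mem.restartIfNeeded := Impl.ite (.natLt .m .a) .restart .id

theorem Impl.advance : Impl Mem.advance :=
  Impl.ite (.natLt .b_succ .n)
    (.ite (.forall_fintype fun c => .realLe (((RComp.top c).max (.ext .b_succ c)).add
      ((RComp.top (opp c)).max (.ext .b_succ (opp c)))) .one) .push
      (Impl.shrink.comp .restartIfNeeded)) (.set_d .n)

theorem Impl.step : Impl Mem.step :=
  Impl.ite (.natLt .a .k) .rebuild (Impl.solve.comp .advance)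

theorem Impl.init : Impl Mem.init :=
  (Impl.set_S (.const 0) fun c => .ext (.const 0) c).comp
    ((Impl.set_F fun c => .ext (.const 0) c).comp
      (.set_result (.t (.const 0)) (.t (.const 0)) .zero))

end RealRAM

/-! ## Correctness -/

namespace RealRAM

open Trajectory

variable {n : ℕ} {T : Trajectory n} {s : Mem}

/-- The variables `n`, `x`, `y`, `t` describe the trajectory `T`. -/
structure Describes (T : Trajectory n) (s : Mem) : Prop where
  n_eq : s.n = n
  x_eq : ∀ k < n, s.x k = T.vertexAt k 0
  y_eq : ∀ k < n, s.y k = T.vertexAt k 1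
  t_eq : ∀ k < n, s.t k = T.timeAt k

/-- The part of the invariant that does not concern the recomputation of the arrays. -/
structure Core (T : Trajectory n) (s : Mem) : Prop where
  describes : Describes T s
  a_le_b : s.a ≤ s.b
  b_lt : s.b < n
  D_eq : s.D = T.arc (T.timeAt s.b) - T.arc (T.timeAt s.a)
  window : ∀ c i j, s.a ≤ i → i ≤ s.b → s.a ≤ j → j ≤ s.b →
    extent c (T.vertexAt i) + extent (opp c) (T.vertexAt j) ≤ 1
  result : T.IsCoverableSub 1 s.bs s.bt ∧ s.best = T.arc s.bt - T.arc s.bs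
  -- The second alternative is for pieces that fall inside the window when `b` advances. They are
  -- settled at the next solve, where the window itself is a candidate.
  dominated : ∀ p q, T.IsCoverableSub 1 p q → p < T.timeAt (s.a - 1) ∨ q < T.timeAt s.b →
    T.arc q - T.arc p ≤ s.best ∨ T.timeAt s.a ≤ p ∧ q ≤ T.timeAt s.b
  done : s.d = 0 ∨ s.d = n ∧ ∀ p q, T.IsCoverableSub 1 p q → T.arc q - T.arc p ≤ s.best

/-- The invariant of the main loop. -/
structure Invariant (T : Trajectory n) (s : Mem) : Prop extends Core T s where
  le_m : s.a ≤ s.m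
  m_le : s.m ≤ s.b
  k_le : s.k ≤ s.m
  S_max : ∀ c i, s.k ≤ i → s.a ≤ i → i ≤ s.m → T.IsWindowMax c i s.m (s.S c i)
  F_max : ∀ c, T.IsWindowMax c s.m s.b (s.F c)

/-- The best subtrajectory so far is at least as long as any coverable subtrajectory that the current
linear program and the earlier ones account for. -/
structure Solved (T : Trajectory n) (s : Mem) : Prop extends Invariant T s where
  k_le_a : s.k ≤ s.a
  d_eq : s.d = 0
  window_le : T.arc (T.timeAt s.b) - T.arc (T.timeAt s.a) ≤ s.best
  le_best : ∀ p q, T.IsCoverableSub 1 p q → p < T.timeAt (s.a - 1) ∨ q < T.timeAt s.b ∨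
    p ≤ T.timeAt s.a ∧ q ≤ T.timeAt (s.b + 1) → T.arc q - T.arc p ≤ s.best

theorem Describes.ext_eq (h : Describes T s) (c : Fin 4) {k : ℕ} (hk : k < n) :
    s.ext c k = extent c (T.vertexAt k) := by
  rw [Mem.ext, extent, h.x_eq k hk, h.y_eq k hk]

theorem Describes.edge_eq (h : Describes T s) {k l : ℕ} (hk : k < n) (hl : l < n) :
    s.edge k l = dist (T.vertexAt k) (T.vertexAt l) := by
  rw [Mem.edge, h.x_eq k hk, h.y_eq k hk, h.x_eq l hl, h.y_eq l hl, dist_vertexAt]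

theorem Describes.next_lt (h : Describes T s) : s.next < n := by
  have := T.pos
  have := h.n_eq
  unfold Mem.next
  omega

theorem Describes.timeAt_next (h : Describes T s) : T.timeAt s.next = T.timeAt (s.b + 1) := by
  have := h.n_eq
  by_cases hb : s.b + 1 < n
  · congr 1
    unfold Mem.next
    omega
  · rw [T.timeAt_of_ge (k := s.next) (by unfold Mem.next; omega), T.timeAt_of_ge (by omega)]

theorem Describes.vertexAt_next (h : Describes T s) :
    T.vertexAt s.next = T.vertexAt (s.b + 1) := by
  rw [vertexAt, h.timeAt_next, vertexAt]

theorem arc_succ (k : ℕ) : T.arc (T.timeAt (k + 1)) =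
    T.arc (T.timeAt k) + dist (T.vertexAt k) (T.vertexAt (k + 1)) := by
  have := T.arc_lineMap (Or.inr rfl : k + 1 = k ∨ k + 1 = k + 1) (Set.right_mem_Icc.2 zero_le_one)
  rwa [AffineMap.lineMap_apply_one, one_mul] at this

theorem pred_edge (a : ℕ) : a = a - 1 ∨ a = a - 1 + 1 := by omega

theorem IsWindowMax.add_le_iff {c : Fin 4} {a b : ℕ} {M M' z : ℝ} (h : T.IsWindowMax c a b M)
    (h' : T.IsWindowMax (opp c) a b M') :
    M + M' ≤ z ↔ ∀ i j, a ≤ i → i ≤ b → a ≤ j → j ≤ b →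
      extent c (T.vertexAt i) + extent (opp c) (T.vertexAt j) ≤ z := by
  constructor
  · intro hz i j h1 h2 h3 h4
    linarith [(h M).1 le_rfl i h1 h2, (h' M').1 le_rfl j h3 h4]
  · intro hz
    rw [← le_sub_iff_add_le, h]
    intro i h1 h2
    rw [le_sub_comm, h']
    intro j h3 h4
    linarith [hz i j h1 h2 h3 h4]

/-! ### The linear program of a window -/

namespace Invariant

theorem a_lt (h : Invariant T s) : s.a < n := h.a_le_b.trans_lt h.b_lt

theorem top_max (h : Invariant T s) (hk : s.k ≤ s.a) (c : Fin 4) :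
    T.IsWindowMax c s.a s.b (s.top c) :=
  IsWindowMax.max (h.S_max c s.a hk le_rfl h.le_m) (h.F_max c) h.le_m h.m_le

/-- Constraints with first index 0 confine `u` and `w` to the unit interval; the others are those of
`isCoverable_trace_iff`. The comparison of the window with itself is absent from the program because
the invariant guarantees it. -/
theorem feasible_iff (h : Invariant T s) (hk : s.k ≤ s.a) {u w : ℝ} :
    s.Feasible u w ↔ (u ∈ Set.Icc (0 : ℝ) 1 ∧ w ∈ Set.Icc (0 : ℝ) 1) ∧
      IsCoverable 1 (T.trace (AffineMap.lineMap (T.timeAt (s.a - 1)) (T.timeAt s.a) u)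
        (AffineMap.lineMap (T.timeAt s.b) (T.timeAt (s.b + 1)) w)) := by
  have hbox : s.Feasible u w ↔ (u ∈ Set.Icc (0 : ℝ) 1 ∧ w ∈ Set.Icc (0 : ℝ) 1) ∧
      ∀ i c, i ≠ 0 → s.coefA (i, c) * u + s.coefB (i, c) * w ≤ s.coefC (i, c) := by
    constructor
    · intro H
      have h0 := H (0, 0)
      have h1 := H (0, 1)
      have h2 := H (0, 2)
      have h3 := H (0, 3)
      simp [Mem.coefA, Mem.coefB, Mem.coefC] at h0 h1 h2 h3
      exact ⟨⟨⟨h1, h0⟩, h3, h2⟩, fun i c _ => H (i, c)⟩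
    · rintro ⟨⟨⟨h1, h0⟩, h3, h2⟩, H⟩ ⟨i, c⟩
      by_cases hi : i = 0
      · subst hi
        fin_cases c <;> simpa [Mem.coefA, Mem.coefB, Mem.coefC]
      · exact H i c hi
  rw [hbox]
  refine and_congr_right fun ⟨hu, hw⟩ => ?_
  have hd := h.describes
  have ha := h.a_lt
  have hle : T.timeAt (s.a - 1) ≤ T.timeAt s.a := T.timeAt_mono (by omega)
  have hle' : T.timeAt s.b ≤ T.timeAt (s.b + 1) := T.timeAt_mono (by omega)
  have h1 := lineMap_mono hle hu.1
  have h2 := lineMap_mono hle hu.2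
  have h3 := lineMap_mono hle' hw.1
  have h4 := lineMap_mono hle' hw.2
  rw [AffineMap.lineMap_apply_zero] at h1 h3
  rw [AffineMap.lineMap_apply_one] at h2 h4
  rw [isCoverable_trace_iff (h.top_max hk) h.a_le_b h1 h2 h3 h4]
  have hp : ∀ c, extent c (T.curve (AffineMap.lineMap (T.timeAt (s.a - 1)) (T.timeAt s.a) u)) =
      s.ext c (s.a - 1) + u * (s.ext c s.a - s.ext c (s.a - 1)) := fun c => by
    rw [T.curve_lineMap (pred_edge _) hu, extent_lineMap, hd.ext_eq c ha,
      hd.ext_eq c (by omega : s.a - 1 < n)]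
  have hq : ∀ c, extent c (T.curve (AffineMap.lineMap (T.timeAt s.b) (T.timeAt (s.b + 1)) w)) =
      s.ext c s.b + w * (s.ext c s.next - s.ext c s.b) := fun c => by
    rw [T.curve_lineMap (Or.inr rfl) hw, extent_lineMap, hd.ext_eq c h.b_lt,
      hd.ext_eq c hd.next_lt, hd.vertexAt_next]
  simp only [hp, hq]
  constructor
  · intro H c
    have h1 := H 1 c (by decide)
    have h2 := H 2 c (by decide)
    have h3 := H 3 c (by decide)
    simp [Mem.coefA, Mem.coefB, Mem.coefC] at h1 h2 h3
    exact ⟨by linarith, by linarith, by linarith,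
      (IsWindowMax.add_le_iff (h.top_max hk c) (h.top_max hk (opp c))).2 (h.window c)⟩
  · intro H i c hi
    obtain ⟨h1, h2, h3, -⟩ := H c
    fin_cases i
    · exact absurd rfl hi
    all_goals
      simp [Mem.coefA, Mem.coefB, Mem.coefC]
      linarith

theorem value_eq (h : Invariant T s) {u w : ℝ} (hu : u ∈ Set.Icc (0 : ℝ) 1)
    (hw : w ∈ Set.Icc (0 : ℝ) 1) : s.value u w =
      T.arc (AffineMap.lineMap (T.timeAt s.b) (T.timeAt (s.b + 1)) w) -
        T.arc (AffineMap.lineMap (T.timeAt (s.a - 1)) (T.timeAt s.a) u) := by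
  have hd := h.describes
  have ha := h.a_lt
  have h1 := T.arc_lineMap (pred_edge s.a) (Set.right_mem_Icc.2 zero_le_one)
  rw [AffineMap.lineMap_apply_one, one_mul] at h1
  rw [T.arc_lineMap (pred_edge s.a) hu, T.arc_lineMap (Or.inr rfl) hw, Mem.value, h.D_eq, h1,
    hd.edge_eq (by omega) ha, hd.edge_eq h.b_lt hd.next_lt, hd.vertexAt_next]
  ring

theorem startAt_eq (h : Invariant T s) (u : ℝ) :
    s.startAt u = AffineMap.lineMap (T.timeAt (s.a - 1)) (T.timeAt s.a) u := by
  have ha := h.a_lt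
  rw [Mem.startAt, h.describes.t_eq _ ha, h.describes.t_eq (s.a - 1) (by omega),
    AffineMap.lineMap_apply_module', smul_eq_mul, add_comm]

theorem endAt_eq (h : Invariant T s) (w : ℝ) :
    s.endAt w = AffineMap.lineMap (T.timeAt s.b) (T.timeAt (s.b + 1)) w := by
  rw [Mem.endAt, h.describes.t_eq _ h.b_lt, h.describes.t_eq _ h.describes.next_lt,
    h.describes.timeAt_next, AffineMap.lineMap_apply_module', smul_eq_mul, add_comm]

/-- Feasible parameters describe coverable subtrajectories. -/
theorem of_feasible (h : Invariant T s) (hk : s.k ≤ s.a) {u w : ℝ} (huw : s.Feasible u w) :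
    T.IsCoverableSub 1 (s.startAt u) (s.endAt w) ∧
      s.value u w = T.arc (s.endAt w) - T.arc (s.startAt u) := by
  obtain ⟨⟨hu, hw⟩, hc⟩ := (h.feasible_iff hk).1 huw
  rw [h.startAt_eq, h.endAt_eq]
  refine ⟨⟨?_, ?_, ?_, hc⟩, h.value_eq hu hw⟩
  all_goals
    have hle : T.timeAt (s.a - 1) ≤ T.timeAt s.a := T.timeAt_mono (by omega)
    have hle' : T.timeAt s.b ≤ T.timeAt (s.b + 1) := T.timeAt_mono (by omega)
    have hab : T.timeAt s.a ≤ T.timeAt s.b := T.timeAt_mono h.a_le_b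
    have h1 := lineMap_mono hle hu.1
    have h2 := lineMap_mono hle hu.2
    have h3 := lineMap_mono hle' hw.1
    have h4 := lineMap_mono hle' hw.2
    rw [AffineMap.lineMap_apply_zero] at h1 h3
    rw [AffineMap.lineMap_apply_one] at h2 h4
  · exact (T.startTime_le _).trans h1
  · exact h2.trans (hab.trans h3)
  · exact h4.trans (T.le_endTime _)

end Invariant

/-- The box constraints block every direction, so the program is bounded and `exists_vertex_ge`
applies; the constant part of the value plays no role. -/
theorem Mem.exists_cross_ge {u w : ℝ} (hf : s.Feasible u w) :
    ∃ p, s.Feasible (s.crossU p) (s.crossW p) ∧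
      s.value u w ≤ s.value (s.crossU p) (s.crossW p) := by
  have hb : ∀ d e : ℝ, d ≠ 0 ∨ e ≠ 0 → ∃ i, 0 < s.coefA i * d + s.coefB i * e := by
    intro d e hde
    rcases hde with hd | he
    · rcases hd.lt_or_gt with hd | hd
      · exact ⟨(0, 1), by simpa [Mem.coefA, Mem.coefB] using hd⟩
      · exact ⟨(0, 0), by simpa [Mem.coefA, Mem.coefB] using hd⟩
    · rcases he.lt_or_gt with hd | hd
      · exact ⟨(0, 3), by simpa [Mem.coefA, Mem.coefB] using hd⟩
      · exact ⟨(0, 2), by simpa [Mem.coefA, Mem.coefB] using hd⟩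
  obtain ⟨k, l, _, _, rfl, rfl, hfeas, hle⟩ :=
    exists_vertex_ge hb hf (-s.edge (s.a - 1) s.a) (s.edge s.b s.next)
  refine ⟨(k, l), hfeas, ?_⟩
  simp only [Mem.value, Mem.crossU, Mem.crossW]
  linarith

/-- The constraints and the objective do not involve the record so far, so every candidate of the
fold is judged by the same program. `G` stands for any property shared by the initial record and all
feasible candidates. -/
theorem foldl_improve {G : ℝ → ℝ → ℝ → Prop} (l : List ((Fin 4 × Fin 4) × (Fin 4 × Fin 4)))
    (hG : ∀ u w, s.Feasible u w → G (s.startAt u) (s.endAt w) (s.value u w))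
    (h0 : G s.bs s.bt s.best) :
    ∃ p q z, l.foldl Mem.improve s = { s with bs := p, bt := q, best := z } ∧ G p q z ∧
      s.best ≤ z ∧ ∀ i ∈ l, s.Feasible (s.crossU i) (s.crossW i) →
        s.value (s.crossU i) (s.crossW i) ≤ z := by
  induction l generalizing s with
  | nil => exact ⟨_, _, _, rfl, h0, le_rfl, by simp⟩
  | cons i l ih =>
    rw [List.foldl_cons]
    obtain ⟨p₁, q₁, z₁, he, hG₁, hz₁, hi⟩ : ∃ p q z,
        s.improve i = { s with bs := p, bt := q, best := z } ∧ G p q z ∧ s.best ≤ z ∧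
          (s.Feasible (s.crossU i) (s.crossW i) → s.value (s.crossU i) (s.crossW i) ≤ z) := by
      unfold Mem.improve
      split_ifs with hf hv
      · exact ⟨_, _, _, rfl, h0, le_rfl, fun _ => hv⟩
      · exact ⟨_, _, _, rfl, hG _ _ hf, (not_le.1 hv).le, fun _ => le_rfl⟩
      · exact ⟨_, _, _, rfl, h0, le_rfl, fun h => absurd h hf⟩
    obtain ⟨p, q, z, he', hGz, hz, hl⟩ :=
      ih (s := { s with bs := p₁, bt := q₁, best := z₁ }) hG hG₁
    refine ⟨p, q, z, by rw [he, he'], hGz, hz₁.trans hz, fun j hj => ?_⟩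
    rcases List.mem_cons.1 hj with rfl | hj
    exacts [fun hf => (hi hf).trans hz, hl j hj]

namespace Invariant

/-- Solving the linear program only changes the best subtrajectory so far. -/
theorem solve (h : Invariant T s) (hk : s.k ≤ s.a) (hd : s.d = 0) :
    Solved T s.solve ∧ ∃ p q z, s.solve = { s with bs := p, bt := q, best := z } := by
  obtain ⟨p, q, z, he, hG, hz, hi⟩ := foldl_improve (s := s)
    (G := fun p q z => T.IsCoverableSub 1 p q ∧ z = T.arc q - T.arc p)
    (Finset.univ : Finset ((Fin 4 × Fin 4) × (Fin 4 × Fin 4))).toList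
    (fun u w huw => h.of_feasible hk huw) h.result
  change s.solve = _ at he
  have hab : T.timeAt s.a ≤ T.timeAt s.b := T.timeAt_mono h.a_le_b
  have key : ∀ p' q', T.timeAt (s.a - 1) ≤ p' → p' ≤ T.timeAt s.a → T.timeAt s.b ≤ q' →
      q' ≤ T.timeAt (s.b + 1) → IsCoverable 1 (T.trace p' q') → T.arc q' - T.arc p' ≤ z := by
    intro p' q' h1 h2 h3 h4 hc
    obtain ⟨u, hu, rfl⟩ := exists_lineMap h1 h2
    obtain ⟨w, hw, rfl⟩ := exists_lineMap h3 h4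
    rw [← h.value_eq hu hw]
    obtain ⟨i, hfi, hle⟩ := Mem.exists_cross_ge ((h.feasible_iff hk).2 ⟨⟨hu, hw⟩, hc⟩)
    exact hle.trans (hi i (by simp) hfi)
  -- The window itself is a candidate (`u = 1`, `w = 0`), which removes the second alternative of
  -- `dominated`.
  have hwin : T.arc (T.timeAt s.b) - T.arc (T.timeAt s.a) ≤ z := by
    refine key _ _ (T.timeAt_mono (by omega)) le_rfl le_rfl (T.timeAt_mono (by omega)) ?_
    rw [isCoverable_trace_iff (h.top_max hk) h.a_le_b (T.timeAt_mono (by omega)) le_rfl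
      le_rfl (T.timeAt_mono (by omega))]
    intro c
    have hb := h.a_le_b
    have hM := (IsWindowMax.add_le_iff (h.top_max hk c) (h.top_max hk (opp c))).2 (h.window c)
    have h1 : extent c (T.curve (T.timeAt s.a)) ≤ _ := (h.top_max hk c _).1 le_rfl s.a le_rfl hb
    have h2 : extent c (T.curve (T.timeAt s.b)) ≤ _ := (h.top_max hk c _).1 le_rfl s.b hb le_rfl
    have h3 : extent (opp c) (T.curve (T.timeAt s.b)) ≤ _ :=
      (h.top_max hk (opp c) _).1 le_rfl s.b hb le_rfl
    exact ⟨by linarith, by linarith, by linarith, hM⟩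
  have hdom : ∀ p' q', T.IsCoverableSub 1 p' q' → p' < T.timeAt (s.a - 1) ∨ q' < T.timeAt s.b →
      T.arc q' - T.arc p' ≤ z := by
    intro p' q' hc hor
    rcases h.dominated p' q' hc hor with hle | ⟨h1, h2⟩
    · exact hle.trans hz
    · have e1 := T.arc_mono (T.startTime_le _) h1 (hc.2.1.trans hc.2.2.1)
      have e2 := T.arc_mono (hc.1.trans hc.2.1) h2 (T.le_endTime _)
      linarith
  refine ⟨?_, p, q, z, he⟩
  rw [he]
  refine ⟨⟨⟨⟨h.describes.n_eq, h.describes.x_eq, h.describes.y_eq, h.describes.t_eq⟩, h.a_le_b,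
    h.b_lt, h.D_eq, h.window, hG, fun p' q' hc hor => .inl (hdom p' q' hc hor), .inl hd⟩, h.le_m,
    h.m_le, h.k_le, h.S_max, h.F_max⟩, hk, hd, hwin, ?_⟩
  intro p' q' hc h1
  by_cases hor : p' < T.timeAt (s.a - 1) ∨ q' < T.timeAt s.b
  · exact hdom p' q' hc hor
  · push Not at hor
    rcases h1 with h1 | h1 | ⟨h1, h2⟩
    · exact absurd h1 hor.1.not_gt
    · exact absurd h1 hor.2.not_gt
    · exact key p' q' hor.1 h1 hor.2 h2 hc.2.2.2

theorem rebuild (h : Invariant T s) (hk : s.a < s.k) : Invariant T s.rebuild where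
  describes := ⟨h.describes.n_eq, h.describes.x_eq, h.describes.y_eq, h.describes.t_eq⟩
  a_le_b := h.a_le_b
  le_m := h.le_m
  m_le := h.m_le
  b_lt := h.b_lt
  k_le := (Nat.sub_le _ _).trans h.k_le
  S_max c i hi hai him := by
    simp only [Mem.rebuild] at hi hai him ⊢
    have hkm := h.k_le
    have hmb := h.m_le
    have hbn := h.b_lt
    rcases hi.eq_or_lt with rfl | hi
    · rw [Function.update_self, h.describes.ext_eq c (by omega)]
      refine IsWindowMax.cons ?_ (by omega)
      rw [Nat.sub_add_cancel (by omega)]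
      exact h.S_max c s.k le_rfl hk.le h.k_le
    · rw [Function.update_of_ne hi.ne']
      exact h.S_max c i (by omega) hai him
  F_max := h.F_max
  D_eq := h.D_eq
  window := h.window
  result := h.result
  dominated := h.dominated
  done := h.done

end Invariant

end RealRAM

/-! ### Moving the window preserves the invariant -/

namespace RealRAM

open Trajectory

variable {n : ℕ} {T : Trajectory n} {s : Mem}

theorem Describes.congr (h : Describes T s) {s' : Mem} (hn : s'.n = s.n) (hx : s'.x = s.x)
    (hy : s'.y = s.y) (ht : s'.t = s.t) : Describes T s' :=
  ⟨hn ▸ h.n_eq, hx ▸ h.x_eq, hy ▸ h.y_eq, ht ▸ h.t_eq⟩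

/-- With `m = k = b`, the arrays and the running maximum concern the single vertex `b`, so nothing
about their old contents is needed. -/
theorem Core.restart (h : Core T s) : Invariant T s.restart where
  describes := h.describes.congr rfl rfl rfl rfl
  a_le_b := h.a_le_b
  b_lt := h.b_lt
  D_eq := h.D_eq
  window := h.window
  result := h.result
  dominated := h.dominated
  done := h.done
  le_m := h.a_le_b
  m_le := le_rfl
  k_le := le_rfl
  S_max c i hi _ him := by
    obtain rfl := le_antisymm him hi
    simp only [Mem.restart, Function.update_self]
    rw [h.describes.ext_eq c h.b_lt]
    exact isWindowMax_self
  F_max c := by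
    simp only [Mem.restart]
    rw [h.describes.ext_eq c h.b_lt]
    exact isWindowMax_self

/-- A coverable subtrajectory of an edge can be moved to the start of the edge. -/
theorem exists_isCoverableSub_of_edge {b : ℕ} (hb : b + 1 < n) {p q : ℝ}
    (hc : T.IsCoverableSub 1 p q) (hp : T.timeAt b ≤ p) (hq : q ≤ T.timeAt (b + 1)) :
    ∃ r, r ≤ T.timeAt (b + 1) ∧ T.IsCoverableSub 1 (T.timeAt b) r ∧
      T.arc r - T.arc (T.timeAt b) = T.arc q - T.arc p := by
  obtain ⟨-, hpq, -, hcov⟩ := hc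
  have hlt := T.timeAt_lt hb
  have hmp : T.curve p ∈ T.trace p q := ⟨p, ⟨le_rfl, hpq⟩, rfl⟩
  have hmq : T.curve q ∈ T.trace p q := ⟨q, ⟨hpq, le_rfl⟩, rfl⟩
  obtain ⟨u, hu, rfl⟩ := exists_lineMap hp (hpq.trans hq)
  obtain ⟨w, hw, rfl⟩ := exists_lineMap (hp.trans hpq) hq
  have huw : u ≤ w := by
    simp only [AffineMap.lineMap_apply_module', smul_eq_mul] at hpq
    nlinarith
  have hwu : w - u ∈ Set.Icc (0 : ℝ) 1 := ⟨by linarith, by linarith [hu.1, hw.2]⟩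
  have h1 := lineMap_mono hlt.le hwu.1
  have h2 := lineMap_mono hlt.le hwu.2
  rw [AffineMap.lineMap_apply_zero] at h1
  rw [AffineMap.lineMap_apply_one] at h2
  refine ⟨AffineMap.lineMap (T.timeAt b) (T.timeAt (b + 1)) (w - u), h2, ⟨T.startTime_le b, h1,
    h2.trans (T.le_endTime _), ?_⟩, ?_⟩
  · rw [isCoverable_trace_iff (fun c => isWindowMax_self) le_rfl (T.timeAt_mono (Nat.sub_le b 1))
      le_rfl h1 h2]
    intro c
    have e0 := extent_add_opp c (T.vertexAt b)
    have e1 := isCoverable_one_iff.1 hcov (opp c) _ hmq _ hmp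
    have e2 := isCoverable_one_iff.1 hcov c _ hmq _ hmp
    have e3 := extent_add_opp c (T.vertexAt (b + 1))
    have hv : T.curve (T.timeAt b) = T.vertexAt b := rfl
    rw [opp_opp] at e1
    rw [T.curve_lineMap (Or.inr rfl) hu, T.curve_lineMap (Or.inr rfl) hw] at e1 e2
    rw [T.curve_lineMap (Or.inr rfl) hwu, hv]
    simp only [extent_lineMap] at e1 e2 ⊢
    have hopp : extent (opp c) (T.vertexAt b) = -extent c (T.vertexAt b) := by linarith
    have hopp' : extent (opp c) (T.vertexAt (b + 1)) = -extent c (T.vertexAt (b + 1)) := by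
      linarith
    rw [hopp, hopp'] at e1 e2
    simp only [hopp, hopp']
    exact ⟨by linarith, by linarith, by linarith, by linarith⟩
  · rw [T.arc_lineMap (Or.inr rfl) hwu, T.arc_lineMap (Or.inr rfl) hw,
      T.arc_lineMap (Or.inr rfl) hu]
    ring

namespace Solved

theorem push (h : Solved T s) (hb : s.b + 1 < n)
    (hcov : ∀ c, max (s.top c) (s.ext c (s.b + 1)) +
      max (s.top (opp c)) (s.ext (opp c) (s.b + 1)) ≤ 1) : Invariant T s.push where
  describes := h.describes.congr rfl rfl rfl rfl
  a_le_b := h.a_le_b.trans s.b.le_succ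
  b_lt := hb
  D_eq := by
    simp only [Mem.push]
    rw [h.D_eq, arc_succ, h.describes.edge_eq h.b_lt hb]
    ring
  window c := by
    have := hcov c
    rw [h.describes.ext_eq _ hb, h.describes.ext_eq _ hb] at this
    exact (IsWindowMax.add_le_iff ((h.top_max h.k_le_a c).snoc h.a_le_b)
      ((h.top_max h.k_le_a (opp c)).snoc h.a_le_b)).1 this
  result := h.result
  dominated p q hc hor := by
    simp only [Mem.push] at hor ⊢
    rcases hor with hor | hor
    · exact .inl (h.le_best p q hc (.inl hor))
    -- Either the program just solved accounts for the piece, or it lies inside the enlarged window.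
    · rcases le_total p (T.timeAt s.a) with hp | hp
      · exact .inl (h.le_best p q hc (.inr (.inr ⟨hp, hor.le⟩)))
      · exact .inr ⟨hp, hor.le⟩
  done := .inl h.d_eq
  le_m := h.le_m
  m_le := h.m_le.trans s.b.le_succ
  k_le := h.k_le
  S_max := h.S_max
  F_max c := by
    simp only [Mem.push]
    rw [h.describes.ext_eq _ hb]
    exact (h.F_max c).snoc h.m_le

/-- When the window cannot be extended, subtrajectories starting before it end before its next
vertex. -/
theorem le_best_of_not_coverable (h : Solved T s) (hb : s.b + 1 < n)
    (hcov : ¬ ∀ c, max (s.top c) (s.ext c (s.b + 1)) +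
      max (s.top (opp c)) (s.ext (opp c) (s.b + 1)) ≤ 1) {p q : ℝ} (hc : T.IsCoverableSub 1 p q)
    (hp : p < T.timeAt s.a) : T.arc q - T.arc p ≤ s.best := by
  refine h.le_best p q hc (.inr (.inr ⟨hp.le, le_of_not_ge fun hq => hcov fun c => ?_⟩))
  rw [h.describes.ext_eq _ hb, h.describes.ext_eq _ hb,
    IsWindowMax.add_le_iff ((h.top_max h.k_le_a c).snoc h.a_le_b)
      ((h.top_max h.k_le_a (opp c)).snoc h.a_le_b)]
  have hmem : ∀ i, s.a ≤ i → i ≤ s.b + 1 → T.vertexAt i ∈ T.trace p q := fun i h1 h2 =>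
    ⟨_, ⟨hp.le.trans (T.timeAt_mono h1), (T.timeAt_mono h2).trans hq⟩, rfl⟩
  exact fun i j h1 h2 h3 h4 =>
    isCoverable_one_iff.1 hc.2.2.2 c _ (hmem i h1 h2) _ (hmem j h3 h4)

/-- Pieces starting before the old `a` are accounted for because the window is blocked. If the
window keeps more than its first vertex, `b` does not move and earlier programs cover the rest;
otherwise the pieces inside the edge after `b` remain. -/
theorem shrink (h : Solved T s) (hb : s.b + 1 < n)
    (hcov : ¬ ∀ c, max (s.top c) (s.ext c (s.b + 1)) +
      max (s.top (opp c)) (s.ext (opp c) (s.b + 1)) ≤ 1) : Core T s.shrink := by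
  unfold Mem.shrink
  split_ifs with hab
  · have hab : s.a = s.b := by have := h.a_le_b; omega
    have h0 : s.a + 1 < n := by omega
    exact
    { describes := h.describes.congr rfl rfl rfl rfl
      a_le_b := by simp [hab]
      b_lt := hb
      D_eq := by simp [h.D_eq, hab]
      window := fun c i j h1 h2 h3 h4 => by
        simp only at h1 h2 h3 h4
        obtain rfl : i = s.b + 1 := by omega
        obtain rfl : j = s.b + 1 := by omega
        rw [extent_add_opp]
        exact zero_le_one
      result := h.result
      dominated := fun p q hc hor => by
        refine .inl ?_
        simp only [Nat.add_sub_cancel] at hor ⊢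
        by_cases hp : p < T.timeAt s.a
        · exact h.le_best_of_not_coverable hb hcov hc hp
        · have hq := hor.resolve_left hp
          obtain ⟨r, hr, hcr, hlen⟩ :=
            exists_isCoverableSub_of_edge hb hc (hab ▸ not_lt.1 hp) hq.le
          rw [← hlen]
          exact h.le_best _ _ hcr (.inr (.inr ⟨hab ▸ le_rfl, hr⟩))
      done := .inl h.d_eq }
  · exact
    { describes := h.describes.congr rfl rfl rfl rfl
      a_le_b := by simp only; omega
      b_lt := h.b_lt
      D_eq := by
        simp only
        rw [h.D_eq, arc_succ, h.describes.edge_eq h.a_lt (by omega)]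
        ring
      window := fun c i j h1 h2 h3 h4 =>
        h.window c i j (Nat.le_of_succ_le h1) h2 (Nat.le_of_succ_le h3) h4
      result := h.result
      dominated := fun p q hc hor => by
        refine .inl ?_
        simp only [Nat.add_sub_cancel] at hor ⊢
        rcases hor with hp | hq
        · exact h.le_best_of_not_coverable hb hcov hc hp
        · exact h.le_best p q hc (.inr (.inl hq))
      done := .inl h.d_eq }

theorem restartIfNeeded (h : Solved T s) (hb : s.b + 1 < n)
    (hcov : ¬ ∀ c, max (s.top c) (s.ext c (s.b + 1)) +
      max (s.top (opp c)) (s.ext (opp c) (s.b + 1)) ≤ 1) :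
    Invariant T s.shrink.restartIfNeeded := by
  have hcore := h.shrink hb hcov
  unfold Mem.restartIfNeeded
  split_ifs with hm
  · exact hcore.restart
  · have hmb := h.m_le
    -- Here the one-vertex case cannot occur: it would give `a = b + 1 > m` and force a restart.
    have : s.shrink = { s with D := s.D - s.edge s.a (s.a + 1), a := s.a + 1 } := by
      unfold Mem.shrink at hm ⊢
      rw [if_neg]
      intro hab
      rw [if_pos hab] at hm
      simp only at hm
      omega
    rw [this] at hm hcore ⊢
    simp only at hm
    exact
    { hcore with
      le_m := by simp only; omega
      m_le := h.m_le
      k_le := h.k_le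
      S_max := fun c i hi hai him => h.S_max c i hi (Nat.le_of_succ_le hai) him
      F_max := h.F_max }

theorem finish (h : Solved T s) (hb : ¬ s.b + 1 < n) : Invariant T { s with d := s.n } where
  describes := h.describes.congr rfl rfl rfl rfl
  a_le_b := h.a_le_b
  b_lt := h.b_lt
  D_eq := h.D_eq
  window := h.window
  result := h.result
  dominated := h.dominated
  done := .inr ⟨h.describes.n_eq, fun p q hc => by
    have hbn := h.b_lt
    -- The window now ends at the last vertex, so a piece either starts by vertex `a` and belongs to
    -- the solved program, or lies inside the window.
    have hq : q ≤ T.timeAt s.b := by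
      rw [T.timeAt_of_ge (by omega)]
      exact hc.2.2.1
    rcases le_total p (T.timeAt s.a) with hp | hp
    · exact h.le_best p q hc (.inr (.inr ⟨hp, hq.trans (T.timeAt_mono s.b.le_succ)⟩))
    · have e1 := T.arc_mono (T.startTime_le _) hp (hc.2.1.trans hc.2.2.1)
      have e2 := T.arc_mono (hc.1.trans hc.2.1) hq (T.le_endTime _)
      have := h.window_le
      simp only
      linarith⟩
  le_m := h.le_m
  m_le := h.m_le
  k_le := h.k_le
  S_max := h.S_max
  F_max := h.F_max

theorem advance (h : Solved T s) : Invariant T s.advance := by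
  unfold Mem.advance
  split_ifs with hb hcov
  · exact h.push (h.describes.n_eq ▸ hb) hcov
  · exact h.restartIfNeeded (h.describes.n_eq ▸ hb) hcov
  · exact h.finish (h.describes.n_eq ▸ hb)

end Solved

/-- A bound on the number of remaining iterations of the main loop. -/
def Mem.potential (s : Mem) : ℕ :=
  (s.n - s.a) + (s.n - s.b) + (s.n - s.m) + (s.k - s.a) + (s.n - s.d)

/-- Moving a pointer or setting the flag lowers its own term. A restart raises `k - a`, but no more
than the rise of the pivot lowers `n - m`, and the move of `a` still gains. -/
theorem Solved.potential_advance (h : Solved T s) : s.advance.potential < s.potential := by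
  have := h.describes.n_eq
  have := h.le_m
  have := h.m_le
  have := h.b_lt
  have := h.k_le_a
  have := h.d_eq
  unfold Mem.advance Mem.shrink
  split_ifs <;> simp only [Mem.push, Mem.restartIfNeeded, Mem.restart, Mem.potential]
  · omega
  all_goals try split_ifs
  all_goals try simp only
  all_goals omega

theorem Invariant.step (h : Invariant T s) (hd : s.d < s.n) :
    Invariant T s.step ∧ s.step.potential < s.potential := by
  have hd0 : s.d = 0 := by
    rcases h.done with h0 | h0
    · exact h0
    · exact absurd hd (by rw [h0.1, h.describes.n_eq]; exact lt_irrefl n)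
  unfold Mem.step
  split_ifs with hk
  · refine ⟨h.rebuild hk, ?_⟩
    have := h.k_le
    simp only [Mem.rebuild, Mem.potential]
    omega
  · obtain ⟨hs, p, q, z, he⟩ := h.solve (not_lt.1 hk) hd0
    refine ⟨hs.advance, hs.potential_advance.trans_eq ?_⟩
    rw [he]
    rfl

end RealRAM

/-! ### Initialisation and running time -/

namespace Trajectory

open RealRAM

variable {n : ℕ} (T : Trajectory n)

/-- The initial values of the variables. -/
noncomputable def initialMem : Mem where
  n := n
  a := 0
  b := 0
  m := 0
  k := 0
  d := 0
  bs := 0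
  bt := 0
  best := 0
  D := 0
  F _ := 0
  x := T.input.realArr 0
  y := T.input.realArr 1
  t := T.input.realArr 2
  S c := T.input.realArr (3 + c)

theorem rep_initialMem : Rep T.input T.initialMem := by
  constructor <;> simp [initialMem, input]

theorem vertexAt_eq_vertex {k : ℕ} (hk : k < n) : T.vertexAt k = T.vertex ⟨k, hk⟩ := by
  unfold vertexAt vertex timeAt
  congr 3
  omega

theorem describes_initialMem : Describes T T.initialMem where
  n_eq := rfl
  x_eq k hk := by simp [initialMem, input, hk, vertexAt_eq_vertex]
  y_eq k hk := by simp [initialMem, input, hk, vertexAt_eq_vertex]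
  t_eq k hk := by
    simp only [initialMem, input, hk, timeAt]
    simp
    congr 2
    omega

theorem isCoverableSub_start : T.IsCoverableSub 1 (T.timeAt 0) (T.timeAt 0) := by
  refine ⟨T.startTime_le 0, le_rfl, T.le_endTime 0, ?_⟩
  rw [isCoverable_one_iff, trace, Set.Icc_self, Set.image_singleton]
  rintro c _ rfl _ rfl
  rw [extent_add_opp]
  exact zero_le_one

theorem invariant_init : Invariant T T.initialMem.init where
  describes := T.describes_initialMem.congr rfl rfl rfl rfl
  a_le_b := le_rfl
  b_lt := T.pos
  D_eq := (sub_self _).symm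
  window c i j _ h2 _ h4 := by
    obtain rfl : i = 0 := Nat.le_zero.1 h2
    obtain rfl : j = 0 := Nat.le_zero.1 h4
    rw [extent_add_opp]
    exact zero_le_one
  result := by
    simp only [Mem.init]
    rw [T.describes_initialMem.t_eq 0 T.pos]
    exact ⟨T.isCoverableSub_start, (sub_self _).symm⟩
  dominated p q hc hor := by
    have h1 := hc.1
    have h2 := hc.2.1
    rw [← T.timeAt_zero] at h1
    -- Vacuous: with `a = b = 0` and `0 - 1 = 0`, either alternative puts a time before the start.
    rcases hor with hor | hor
    · exact absurd h1 hor.not_ge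
    · exact absurd (h1.trans h2) hor.not_ge
  done := .inl rfl
  le_m := le_rfl
  m_le := le_rfl
  k_le := le_rfl
  S_max c i _ _ him := by
    obtain rfl : i = 0 := Nat.le_zero.1 him
    simp only [Mem.init, Function.update_self]
    rw [T.describes_initialMem.ext_eq c T.pos]
    exact isWindowMax_self
  F_max c := by
    simp only [Mem.init]
    rw [T.describes_initialMem.ext_eq c T.pos]
    exact isWindowMax_self

theorem isLongestCoverableSub_of_arc_le {s t : ℝ} (h : T.IsCoverableSub 1 s t)
    (hle : ∀ p q, T.IsCoverableSub 1 p q → T.arc q - T.arc p ≤ T.arc t - T.arc s) :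
    T.IsLongestCoverableSub 1 s t := by
  refine ⟨h, fun p q hc => ?_⟩
  rw [(T.length_eq_arc hc.1 hc.2.1 hc.2.2.1).1, (T.length_eq_arc h.1 h.2.1 h.2.2.1).1]
  exact ENNReal.ofReal_le_ofReal (hle p q hc)

end Trajectory

theorem isBigO_linear_mul_log (a b : ℕ) :
    (fun n : ℕ => ((a + b * n : ℕ) : ℝ)) =O[atTop] fun n : ℕ => (n : ℝ) * Real.log n := by
  refine IsBigO.of_bound (a + b) ?_
  filter_upwards [eventually_ge_atTop 3] with n hn
  have hn' : (3 : ℝ) ≤ n := by exact_mod_cast hn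
  -- The threshold 3 exceeds `e`, so the logarithm is at least 1 and a linear bound suffices.
  have hlog : 1 ≤ Real.log n := by
    rw [Real.le_log_iff_exp_le (by linarith)]
    linarith [Real.exp_one_lt_d9]
  have h1 : (n : ℝ) ≤ n * Real.log n := le_mul_of_one_le_right (by linarith) hlog
  rw [Real.norm_of_nonneg (by positivity), Real.norm_of_nonneg (by linarith)]
  push_cast
  have ha : (0 : ℝ) ≤ a := by positivity
  have hb : (0 : ℝ) ≤ b := by positivity
  nlinarith [mul_le_mul_of_nonneg_left h1 ha, mul_le_mul_of_nonneg_left h1 hb]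

theorem mainTheorem3 :
    ∃ (P : RealRAM.Program) (bound : ℕ → ℕ),
      ((fun n : ℕ => (bound n : ℝ)) =O[atTop] fun n : ℕ => (n : ℝ) * Real.log n) ∧
      ∀ (n : ℕ) (T : Trajectory n),
        ∃ (σ : RealRAM.State) (k : ℕ),
          RealRAM.Run P T.input σ k ∧ k ≤ bound n ∧
            T.IsLongestCoverableSub 1 (σ.real 0) (σ.real 1) := by
  obtain ⟨P, c, hP⟩ := RealRAM.Impl.init
  obtain ⟨Q, c', hQ⟩ := RealRAM.Impl.step.loop
  -- `c` pays for the initialisation, 1 for the final failing test, and `c'` for each unit of the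
  -- initial potential `4 * n`.
  refine ⟨.seq P Q, fun n => (c + 1) + (4 * c') * n, isBigO_linear_mul_log _ _, fun n T => ?_⟩
  obtain ⟨σ₁, k₁, r₁, l₁, s₁⟩ := hP _ _ T.rep_initialMem
  obtain ⟨σ₂, k₂, s, r₂, l₂, s₂, h, hd⟩ := hQ (RealRAM.Invariant T) RealRAM.Mem.potential
    (fun s hs hd => hs.step hd) σ₁ _ s₁ T.invariant_init
  have hpot : T.initialMem.init.potential = 4 * n := by
    change (n - 0) + (n - 0) + (n - 0) + (0 - 0) + (n - 0) = 4 * n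
    omega
  refine ⟨σ₂, _, r₁.seq r₂, ?_, ?_⟩
  · rw [hpot] at l₂
    calc k₁ + k₂ ≤ c + (c' * (4 * n) + 1) := by omega
      _ = c + 1 + 4 * c' * n := by ring
  · rw [s₂.bs, s₂.bt]
    obtain ⟨hr, hbest⟩ := h.result
    refine T.isLongestCoverableSub_of_arc_le hr fun p q hc => ?_
    rcases h.done with h0 | h0
    · rw [h0, h.describes.n_eq] at hd
      exact absurd T.pos hd
    · exact hbest ▸ h0.2 p q hc
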